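/- **Setting.** Let $S$ be a finite totally ordered set and $M=(m_{s,t})_{s,t\in S}$ a Coxeter matrix ($m_{s,s}=1$, $m_{s,t}=m_{t,s}\in\{2,3,\dots\}\cup\{\infty\}$ for $s\ne t$). For elements $a,b$ of a monoid let $\Pi(a,b,m)=(ab)^{m/2}$ if $m$ is even and $\Pi(a,b,m)=(ab)^{(m-1)/2}a$ if $m$ is odd. Let $W$ be the Coxeter group of $M$ and $S^f$ the set of those $T\subseteq S$ for which the subgroup $W_T$ generated by $T$ is finite. Let $$A^+=\langle\, \sigma_s\ (s\in S)\mid \Pi(\sigma_s,\sigma_t,m_{s,t})=\Pi(\sigma_t,\sigma_s,m_{s,t})\text{ whenever } m_{s,t}\neq\infty\,\rangle$$ be the Artin monoid. For $T\in S^f$ let $\Delta_T\in A^+$ be the image of the least left common multiple of the generators of the Artin monoid $A_T^+$ of $M|_{T\times T}$ (so $\Delta_\varnothing=1$), and for $\alpha\in A^+$ let $I(\alpha)=\{s\in S\mid \sigma_s \text{ right divides } \alpha\}$. The classifying space $Z=BA^+$ is the CW complex with one $n$-cell for each symbol $[x_1|\dots|x_n]$, $x_i\in A^+\setminus\{1\}$.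 * A cell is *$\mu_1$-essential* if each $x_k\cdots x_n$ ($1\le k\le n$) equals $\Delta_{I_k}$ for some nonempty $I_k\in S^f$; put $I_{n+1}=\varnothing$. The $\mu_1$-depth of a cell is the least $d$ such that $[x_d|\dots|x_n]$ is $\mu_1$-essential ($d=n+1$ if only the empty symbol is). A cell of $\mu_1$-depth $d$ with $1<d\le n$ is *$\mu_1$-collapsible* if $I(x_{d-1}x_d\cdots x_n)=I_d$. * A $\mu_1$-essential cell is *$\mu_2$-essential* if $I_k\setminus I_{k+1}=\{\max I_k\}$ for $1\le k\le n$. The $\mu_2$-depth of a cell is the least $d$ such that $[x_d|\dots|x_n]$ is $\mu_2$-essential. A $\mu_1$-essential cell of $\mu_2$-depth $d$ with $1<d\le n$ is *$\mu_2$-collapsible* if $\max I_{d-1}=\max I_d$. The matching $\mathcal M$ matches each $\mu_1$- (resp. $\mu_2$-) collapsible cell $[x_1|\dots|x_n]$ of $\mu_1$- (resp. $\mu_2$-) depth $d$ with its face $[x_1|\dots|x_{d-1}x_d|\dots|x_n]$. Let $Y$ be the Morse complex of $Z$ with respect to $\mathcal M$, i.e. the quotient of $Z$ obtained by retracting, in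 each matched simplex, the simplex linearly onto the union of its faces other than the matched one. For $T\in S^f$ let $e_T$ be the cell of $Y$ given by the $\mu_2$-essential cell $[x_1|\dots|x_n]$ with $I(x_1\cdots x_n)=T$. **Lemma.** Let $s\ne t$ in $S$ with $m_{s,t}\neq\infty$. For each of $T=\{s\},\{t\},\{s,t\}$ there is exactly one $\mu_2$-essential cell $[x_1|\dots|x_n]$ with $I(x_1\cdots x_n)=T$; it occurs in no pair of $\mathcal M$; for $T=\{s\}$ and $T=\{t\}$ it is $[\sigma_s]$ and $[\sigma_t]$, respectively, and for $T=\{s,t\}$ it is a $2$-cell $[z|w]$. The curves of the edges $[\sigma_s]$ and $[\sigma_t]$ and the boundary curve of $[z|w]$ (starting at its first vertex) give loops $e_{\{s\}}$, $e_{\{t\}}$ and $\beta$ in the $1$-skeleton $Y^1$ at the vertex of $Y$, where $\beta$ is the boundary curve of the $2$-cell $e_{\{s,t\}}$. In $\pi_1(Y^1)$, with products in the order in which loops are traversed, $\beta$ equals, up to orientation (that is, up to inversion), $$\begin{cases}\Pi(e_{\{s\}},e_{\{t\}},m_{s,t})\;\Pi(e_{\{s\}}^{-1},e_{\{t\}}^{-1},m_{s,t})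 & \text{if } m_{s,t}\text{ is even},\\[2pt] \Pi(e_{\{s\}},e_{\{t\}},m_{s,t})\;\Pi(e_{\{t\}}^{-1},e_{\{s\}}^{-1},m_{s,t}) & \text{if } m_{s,t}\text{ is odd}.\end{cases}$$ -/

import Mathlib

open CategoryTheory

noncomputable section

namespace ArtinMorse

universe u

/-! ### Alternating products, Artin monoids -/

/-- The alternating product `Π(a, b, m) = a b a ⋯` with `m` factors. -/
def altProd {G : Type*} [Monoid G] (a b : G) (m : ℕ) : G :=
  if Even m then (a * b) ^ (m / 2) else (a * b) ^ ((m - 1) / 2) * a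

lemma map_altProd {G H : Type*} [Monoid G] [Monoid H] (f : G →* H) (a b : G) (m : ℕ) :
    f (altProd a b m) = altProd (f a) (f b) m := by
  unfold altProd
  split_ifs <;> simp

variable {S : Type u}

/-- The defining relations `Π(s, t, m) = Π(t, s, m)`, `m = m_{s,t}`, for all `s, t` with
`m_{s,t} ≠ ∞`; the entry `∞` of a Coxeter matrix is encoded as `0`. -/
inductive ArtinRel (M : CoxeterMatrix S) : FreeMonoid S → FreeMonoid S → Prop
  | braid (s t : S) (h : M s t ≠ 0) :
      ArtinRel M (altProd (FreeMonoid.of s) (FreeMonoid.of t) (M s t))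
        (altProd (FreeMonoid.of t) (FreeMonoid.of s) (M s t))

/-- The Artin monoid `A⁺` of a Coxeter matrix. -/
abbrev ArtinMonoid (M : CoxeterMatrix S) : Type u := PresentedMonoid (ArtinRel M)

/-- The generator `σ_s` of the Artin monoid. -/
def gen (M : CoxeterMatrix S) (s : S) : ArtinMonoid M := PresentedMonoid.of (ArtinRel M) s

/-- The restriction of a Coxeter matrix to `T × T`. -/
def restrict (M : CoxeterMatrix S) (T : Set S) : CoxeterMatrix T where
  M := fun i j => M i j
  isSymm := by ext i j; exact M.symmetric _ _
  diagonal := fun i => M.diagonal i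
  off_diagonal := fun i j h => M.off_diagonal i j (fun h' => h (Subtype.ext h'))

/-- The natural homomorphism `A_T⁺ → A⁺`, `σ_s ↦ σ_s`. -/
def inclusion (M : CoxeterMatrix S) (T : Set S) : ArtinMonoid (restrict M T) →* ArtinMonoid M :=
  PresentedMonoid.lift (fun s : T => gen M s) (by
    rintro _ _ ⟨s, t, h⟩
    rw [map_altProd, map_altProd]
    simp only [FreeMonoid.lift_eval_of]
    have h1 := map_altProd (PresentedMonoid.mk (ArtinRel M)) (FreeMonoid.of (s : S))
      (FreeMonoid.of (t : S)) (M s t)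
    have h2 := map_altProd (PresentedMonoid.mk (ArtinRel M)) (FreeMonoid.of (t : S))
      (FreeMonoid.of (s : S)) (M s t)
    exact h1.symm.trans ((Quotient.sound (ConGen.Rel.of _ _ (ArtinRel.braid (s : S) t h))).trans h2))

/-- `T ∈ S^f`: the subgroup `W_T` of the Coxeter group generated by `T` is finite. -/
def IsFiniteType (M : CoxeterMatrix S) (T : Set S) : Prop :=
  Finite (Subgroup.closure (M.simple '' T))

/-- `δ` is a least left common multiple of `E`: it is a left multiple of all elements of `E`, and
every left common multiple of `E` is a left multiple of `δ`. -/
def IsLeastLeftCommonMultiple {G : Type*} [Monoid G] (E : Set G) (δ : G) : Prop :=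
  (∀ e ∈ E, ∃ γ, δ = γ * e) ∧ ∀ β, (∀ e ∈ E, ∃ γ, β = γ * e) → ∃ γ, β = γ * δ

/-- `α = Δ_T`, for `T ∈ S^f`: `α` is the image in `A⁺` of the fundamental element of `A_T⁺`,
the least left common multiple of the generators of `A_T⁺`. For `T = ∅` this is `α = 1`. -/
def IsDelta (M : CoxeterMatrix S) (T : Set S) (α : ArtinMonoid M) : Prop :=
  IsFiniteType M T ∧ ∃ δ : ArtinMonoid (restrict M T),
    IsLeastLeftCommonMultiple (Set.range (gen (restrict M T))) δ ∧ inclusion M T δ = α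

/-- `I(α)`, the set of all `s` such that `σ_s` right divides `α`. -/
def rightDivisors (M : CoxeterMatrix S) (α : ArtinMonoid M) : Set S :=
  {s | ∃ β, α = β * gen M s}

/-! ### The matching on the cells of the classifying space

The cells of the classifying space of `A⁺` are the symbols `[x₁|…|xₙ]` with all `xᵢ ≠ 1`; here they
are lists. In this section positions in a list are counted from `0`, so that `c.drop k` is the
subsymbol `[x_{k+1}|…|xₙ]`. -/

/-- A symbol `[x₁|…|xₙ]` that is a (nondegenerate) cell. -/
def IsCell (M : CoxeterMatrix S) (c : List (ArtinMonoid M)) : Prop := ∀ x ∈ c, x ≠ 1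

/-- Every product `x_k ⋯ x_n` is `Δ_T` for some nonempty `T ∈ S^f`. -/
def IsMu1Essential (M : CoxeterMatrix S) (c : List (ArtinMonoid M)) : Prop :=
  IsCell M c ∧ ∀ k < c.length, ∃ T : Set S, T.Nonempty ∧ IsDelta M T (c.drop k).prod

/-- The `μ₁`-depth, counted from `0`; it is at most `n` because the empty symbol is
`μ₁`-essential. -/
def depth1 (M : CoxeterMatrix S) (c : List (ArtinMonoid M)) : ℕ :=
  sInf {j | IsMu1Essential M (c.drop j)}

/-- With `d` the `μ₁`-depth of `c` (counted from `0`): `d` is not the first position, `d` is a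
position of the cell, and `I(x_{d-1} x_d ⋯) = I_d`, where `x_d ⋯ = Δ_{I_d}`. -/
def IsMu1Collapsible (M : CoxeterMatrix S) (c : List (ArtinMonoid M)) : Prop :=
  IsCell M c ∧ 0 < depth1 M c ∧ depth1 M c < c.length ∧
    ∃ T : Set S, IsDelta M T (c.drop (depth1 M c)).prod ∧
      rightDivisors M (c.drop (depth1 M c - 1)).prod = T

variable [LinearOrder S]

/-- A `μ₁`-essential cell with `I_k \ I_{k+1} = {max I_k}` for all `k`, where `x_k ⋯ x_n = Δ_{I_k}`
and `I_{n+1} = ∅`. -/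
def IsMu2Essential (M : CoxeterMatrix S) (c : List (ArtinMonoid M)) : Prop :=
  IsMu1Essential M c ∧ ∀ k < c.length, ∃ (T T' : Set S) (s : S),
    IsDelta M T (c.drop k).prod ∧ IsDelta M T' (c.drop (k + 1)).prod ∧
      T \ T' = {s} ∧ IsGreatest T s

/-- The `μ₂`-depth, counted from `0`. -/
def depth2 (M : CoxeterMatrix S) (c : List (ArtinMonoid M)) : ℕ :=
  sInf {j | IsMu2Essential M (c.drop j)}

/-- A `μ₁`-essential cell with `max I_{d-1} = max I_d` for the `μ₂`-depth `d`. -/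
def IsMu2Collapsible (M : CoxeterMatrix S) (c : List (ArtinMonoid M)) : Prop :=
  IsMu1Essential M c ∧ 0 < depth2 M c ∧ depth2 M c < c.length ∧
    ∃ (T T' : Set S) (s : S), IsDelta M T (c.drop (depth2 M c - 1)).prod ∧
      IsDelta M T' (c.drop (depth2 M c)).prod ∧ IsGreatest T s ∧ IsGreatest T' s

/-- The matching `ℳ = ℳ₁ ∪ ℳ₂`: the cell `c` is matched with its `i`-th face. With positions counted
from `0`, the `i`-th face for `0 < i < n` is the symbol in which the entries at the positions `i - 1`
and `i` are multiplied, so for `i` the depth of `c` it is `[x₁|…|x_{d-1}x_d|…|xₙ]`. -/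
def IsMatched (M : CoxeterMatrix S) (c : List (ArtinMonoid M)) (i : ℕ) : Prop :=
  (IsMu1Collapsible M c ∧ i = depth1 M c) ∨ (IsMu2Collapsible M c ∧ i = depth2 M c)

/-- The cell occurs in no pair of the matching, neither as the cell that is collapsed nor as its
matched face. -/
def IsEssential (M : CoxeterMatrix S) (c : List (ArtinMonoid M)) : Prop :=
  IsCell M c ∧ (∀ i, ¬ IsMatched M c i) ∧
    ∀ (pre post : List (ArtinMonoid M)) (x y : ArtinMonoid M), c = pre ++ (x * y) :: post →
      ¬ IsMatched M (pre ++ x :: y :: post) (pre.length + 1)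

/-- The essential cell `c_T` that gives rise to the cell `e_T`: the `μ₂`-essential cell
`[x₁|…|xₙ]` with `I(x₁ ⋯ xₙ) = T`. A cell is a pair `⟨n, (x₁, …, xₙ)⟩`. -/
def IsCellOf (M : CoxeterMatrix S) (T : Set S) (c : Σ n : ℕ, Fin n → ArtinMonoid M) : Prop :=
  IsMu2Essential M (List.ofFn c.2) ∧ rightDivisors M (List.ofFn c.2).prod = T

/-! ### Morse collapse of the realization of a simplicial set -/

/-- The characteristic map `Δⁿ → |X|` of an `n`-simplex `x` of a simplicial set `X`. -/
def cellMap (X : SSet.{u}) {n : ℕ} (x : X.obj (.op (SimplexCategory.mk n)))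
    (p : stdSimplex ℝ (Fin (n + 1))) : SSet.toTop.obj X :=
  (SSet.toTopSimplex.inv.app (SimplexCategory.mk n) ≫ SSet.toTop.map (SSet.yonedaEquiv.symm x))
    (ULift.up p)

/-- The linear retraction of `Δⁿ⁺¹` onto its `i`-th horn (the union of all faces except the `i`-th
one): a point is moved away from the `i`-th face, towards the `i`-th vertex, along the line on which
the other barycentric coordinates decrease at the same rate, until one of them vanishes. -/
def hornRetraction {n : ℕ} (i : Fin (n + 2)) (p : stdSimplex ℝ (Fin (n + 2))) :
    stdSimplex ℝ (Fin (n + 2)) :=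
  ⟨fun j => if j = i then p i + (n + 1) * ⨅ k : {k // k ≠ i}, p k
      else p j - ⨅ k : {k // k ≠ i}, p k, by
    have h0 : 0 ≤ ⨅ k : {k // k ≠ i}, p k := Real.iInf_nonneg fun k => stdSimplex.zero_le p _
    constructor
    · intro j
      dsimp only
      split_ifs with h
      · have := stdSimplex.zero_le p i
        positivity
      · exact sub_nonneg.2 (ciInf_le (f := fun k : {k // k ≠ i} => p k)
          (Set.finite_range _).bddBelow ⟨j, h⟩)
    · have h1 := stdSimplex.sum_eq_one p
      rw [Fin.sum_univ_succAbove _ i] at h1 ⊢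
      simp only [if_true, Fin.succAbove_ne, if_false, Finset.sum_sub_distrib, Finset.sum_const,
        Finset.card_univ, Fintype.card_fin, nsmul_eq_mul, Nat.cast_add, Nat.cast_one]
      linarith⟩

/-- A matching on the cells of the realization of `X`, given by the set of all pairs `(x, i)` such
that the simplex `x` is matched with its `i`-th face. -/
abbrev Matching (X : SSet.{u}) : Type u :=
  Set (Σ n : ℕ, X.obj (.op (SimplexCategory.mk (n + 1))) × Fin (n + 2))

/-- The identifications made by the collapse: in the closed simplex of each matched pair `(x, i)`,
every point is identified with its image under the retraction onto the `i`-th horn. -/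
inductive CollapseRel (X : SSet.{u}) (P : Matching X) : SSet.toTop.obj X → SSet.toTop.obj X → Prop
  | collapse (n : ℕ) (x : X.obj (.op (SimplexCategory.mk (n + 1)))) (i : Fin (n + 2))
      (h : (⟨n, x, i⟩ : Σ n : ℕ, X.obj (.op (SimplexCategory.mk (n + 1))) × Fin (n + 2)) ∈ P)
      (p : stdSimplex ℝ (Fin (n + 2))) :
      CollapseRel X P (cellMap X x p) (cellMap X x (hornRetraction i p))

/-- The Morse complex of `|X|` with respect to an acyclic matching, with the quotient topology.
If `|X|` is built by attaching one essential cell or one matched pair of cells at a time, then a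
matched pair adds nothing to this quotient (it is retracted onto what is already there), and an
essential cell is attached to it along its attaching map in `|X|` followed by the quotient map. -/
def MorseComplex (X : SSet.{u}) (P : Matching X) : Type u := Quot (CollapseRel X P)

instance (X : SSet.{u}) (P : Matching X) : TopologicalSpace (MorseComplex X P) :=
  inferInstanceAs (TopologicalSpace (Quot (CollapseRel X P)))

/-! ### The complex `Y` -/

/-- The simplicial set whose realization is the classifying space of a monoid: the nerve of the
category with one object. The opposite appears because composition in `SingleObj` is
`f ≫ g = g * f`; with it, the composite of `x` followed by `y` is `x y`. -/
abbrev BarComplex (G : Type u) [Monoid G] : SSet.{u} := nerve (SingleObj Gᵐᵒᵖ)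

/-- The simplex `[x₁|…|xₙ]`. -/
def bar {G : Type u} [Monoid G] {n : ℕ} (x : Fin n → G) :
    (BarComplex G).obj (.op (SimplexCategory.mk n)) :=
  ComposableArrows.mkOfObjOfMapSucc (C := SingleObj Gᵐᵒᵖ) (fun _ => SingleObj.star _)
    (fun i => MulOpposite.op (x i))

/-- The matching `ℳ = ℳ₁ ∪ ℳ₂` on the classifying space of `A⁺`. -/
def artinMatching (M : CoxeterMatrix S) : Matching (BarComplex (ArtinMonoid M)) :=
  {q | ∃ c : Fin (q.1 + 1) → ArtinMonoid M, q.2.1 = bar c ∧ IsMatched M (List.ofFn c) q.2.2}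

/-- The complex `Y` obtained by collapsing the classifying space of `A⁺` along `ℳ`. -/
abbrev Y (M : CoxeterMatrix S) : Type u :=
  MorseComplex (BarComplex (ArtinMonoid M)) (artinMatching M)

/-- The map `Δⁿ → |BA⁺| → Y` given by the simplex `[x₁|…|xₙ]`. For an essential cell it is the
characteristic map of the corresponding cell of `Y`. -/
def charMap (M : CoxeterMatrix S) {n : ℕ} (c : Fin n → ArtinMonoid M)
    (p : stdSimplex ℝ (Fin (n + 1))) : Y M :=
  Quot.mk _ (cellMap (BarComplex (ArtinMonoid M)) (bar c) p)

/-- The `k`-skeleton of `Y`: the union of the closed cells of dimension at most `k`. -/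
def skeleton (M : CoxeterMatrix S) (k : ℕ) : Set (Y M) :=
  {y | ∃ n ≤ k, ∃ c : Fin n → ArtinMonoid M, IsEssential M (List.ofFn c) ∧ y ∈ Set.range (charMap M c)}

/-- The edge of a standard simplex from the `i`-th to the `j`-th vertex. -/
def simplexEdge {n : ℕ} (i j : Fin n) :
    Path (stdSimplex.vertex (S := ℝ) i) (stdSimplex.vertex (S := ℝ) j) where
  toFun τ := ⟨AffineMap.lineMap (Pi.single i 1 : Fin n → ℝ) (Pi.single j 1) (τ : ℝ),
    (convex_stdSimplex ℝ (Fin n)).lineMap_mem (single_mem_stdSimplex ℝ i)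
      (single_mem_stdSimplex ℝ j) τ.2⟩
  continuous_toFun := by
    refine Continuous.subtype_mk ?_ _
    exact AffineMap.lineMap_continuous.comp continuous_subtype_val
  source' := by ext; simp
  target' := by ext; simp

/-- The boundary of the triangle, run through once along the vertices `0, 1, 2, 0`. -/
def triangleBoundary :
    Path (stdSimplex.vertex (S := ℝ) (0 : Fin 3)) (stdSimplex.vertex (S := ℝ) (0 : Fin 3)) :=
  ((simplexEdge 0 1).trans (simplexEdge 1 2)).trans (simplexEdge 2 0)

/-- The curve in `Y` given by the symbol `[x]`, from its vertex `0` to its vertex `1`. -/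
def edgeCurve (M : CoxeterMatrix S) (x : ArtinMonoid M) (τ : unitInterval) : Y M :=
  charMap M ![x] (simplexEdge 0 1 τ)

/-- The curve in `Y` given by the boundary of the simplex `[x|y]`. -/
def boundaryCurve (M : CoxeterMatrix S) (x y : ArtinMonoid M) (τ : unitInterval) : Y M :=
  charMap M ![x, y] (triangleBoundary τ)

/-- The group of homotopy classes (relative to the endpoints) of loops at `v`, with `a * b` the
class of the loop that first runs through `a` and then through `b`. (In Mathlib's
`FundamentalGroup`, `a * b` runs through `b` first.) -/
abbrev LoopGroup (X : Type*) [TopologicalSpace X] (v : X) := (FundamentalGroup X v)ᵐᵒᵖ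

/-- The class of a loop. -/
def loopClass {X : Type*} [TopologicalSpace X] {v : X} (γ : Path v v) : LoopGroup X v :=
  MulOpposite.op (FundamentalGroup.fromPath (Path.Homotopic.Quotient.mk γ))

/-- The word `Π(a, b, m) Π(a⁻¹, b⁻¹, m)` for even `m`, and `Π(a, b, m) Π(b⁻¹, a⁻¹, m)` for odd
`m`. -/
def relatorWord {G : Type*} [Group G] (a b : G) (m : ℕ) : G :=
  if Even m then altProd a b m * altProd a⁻¹ b⁻¹ m else altProd a b m * altProd b⁻¹ a⁻¹ m

end ArtinMorse

end

/-! Let `p < q` be the elements `s`, `t` in order, let `m = M s t`, write `Π_k` for an alternating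
product of `k` of the two generators, and let Δ be the common value of the two products of length
`m`. In a μ₂-essential cell the set `I_k` loses exactly its maximum in passing to `I_{k+1}`. Hence
the cell for `{p, q}` must be `[z|σ_p]` with `z σ_p = Δ`, and its boundary runs through `[z]`,
`[σ_p]` and the reverse of `[Δ]`.

It remains to see what `[z]` and `[Δ]` become in the quotient. If `1 ≤ k` and `k + 1 < m`, the only
generator dividing `Π_{k+1}` on the right is its last letter, so `[Π_k|last letter]` is
μ₁-collapsible and pushes `[Π_{k+1}]` onto `[Π_k]` followed by that letter (`isMatched_altProd`).
The edge `[Δ]` is pushed off along the other factorization `Δ = x σ_q`, since `[x|σ_q]` is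
μ₂-collapsible (`isMatched_pair`). Unrolling both, the boundary is the alternating word of length
`m` ending in `p`, followed by the inverse of the one ending in `q`. This is the relator or its
inverse (`relatorWord_eq`).

The algebra rests on two facts about words: short alternating words are alone in their class, while
Δ has exactly two words (`eq_altProd_of_lt`, `eq_altProd_or`); and Δ is the least left common
multiple in the two-generator Artin monoid (`dihedral_reduction`). On the topological side, the
retraction of the triangle carries the edge from 0 to 2 to the concatenation of the other two edges
with exactly the parametrization of `Path.trans` (`hornRetraction_simplexEdge`). Curves in `Y`
therefore agree pointwise, and loops can be concatenated inside the subspace `Y¹` before passing to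
homotopy classes. -/

noncomputable section

namespace ArtinMorse

universe u

/-! ### Alternating words -/

section AltProd

variable {G : Type*} [Monoid G]

/-- The factor at position `k` (counted from `0`) of the alternating products of `a` and `b`. -/
def altLetter {α : Type*} (a b : α) (k : ℕ) : α := if Even k then a else b

lemma altProd_zero (a b : G) : altProd a b 0 = 1 := by simp [altProd]

/-- Replaces the definition by powers with a recursion on the last factor; all inductions on
alternating products use this form, as right division removes the last factor. -/
lemma altProd_succ (a b : G) (k : ℕ) :
    altProd a b (k + 1) = altProd a b k * altLetter a b k := by
  unfold altProd altLetter
  rcases Nat.even_or_odd' k with ⟨j, rfl | rfl⟩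
  · have h : ¬ Even (2 * j + 1) := by simp
    simp [h]
  · have h : ¬ Even (2 * j + 1) := by simp
    have h' : Even (2 * j + 1 + 1) := by simp [Nat.even_add_one]
    rw [if_pos h', if_neg h, if_neg h]
    have h2 : (2 * j + 1 + 1) / 2 = j + 1 := by omega
    have h3 : (2 * j + 1 - 1) / 2 = j := by omega
    rw [h2, h3, pow_succ, mul_assoc]

lemma altProd_one (a b : G) : altProd a b 1 = a := by simp [altProd]

lemma altLetter_map {α β : Type*} (f : α → β) (a b : α) (k : ℕ) :
    f (altLetter a b k) = altLetter (f a) (f b) k := by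
  unfold altLetter; split_ifs <;> rfl

lemma altLetter_eq_or {α : Type*} (a b : α) (k : ℕ) : altLetter a b k = a ∨ altLetter a b k = b := by
  unfold altLetter; split_ifs <;> simp

lemma altLetter_ne {α : Type*} {a b : α} (h : a ≠ b) (k : ℕ) :
    altLetter a b k ≠ altLetter b a k := by
  unfold altLetter; split_ifs
  exacts [h, h.symm]

lemma eq_altLetter_or {α : Type*} {a b x : α} (h : x = a ∨ x = b) (k : ℕ) :
    x = altLetter a b k ∨ x = altLetter b a k := by
  unfold altLetter; split_ifs
  exacts [h, h.symm]

/-- An alternating word of odd length is a palindrome, while reversing one of even length exchanges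
the two letters. -/
lemma altProd_inv {G : Type*} [Group G] (a b : G) (m : ℕ) :
    (altProd a b m)⁻¹ = if Even m then altProd b⁻¹ a⁻¹ m else altProd a⁻¹ b⁻¹ m := by
  unfold altProd
  split_ifs with h
  · rw [← inv_pow, mul_inv_rev]
  · rw [mul_inv_rev, ← inv_pow, mul_inv_rev, ← mul_pow_mul]

/-- In this form the parity disappears, and exchanging `a` and `b` visibly inverts the word. -/
lemma relatorWord_eq {G : Type*} [Group G] (a b : G) (m : ℕ) :
    relatorWord a b m = altProd a b m * (altProd b a m)⁻¹ := by
  unfold relatorWord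
  rw [altProd_inv]
  split_ifs <;> rfl

end AltProd

/-! ### Words in the free monoid -/

section Words

variable {S : Type u}

lemma length_altProd (s t : S) (k : ℕ) :
    (altProd (FreeMonoid.of s) (FreeMonoid.of t) k).length = k := by
  induction k with
  | zero => simp [altProd_zero]
  | succ k ih => simp [altProd_succ, ih, ← altLetter_map FreeMonoid.of]

lemma mem_altProd {s t x : S} {k : ℕ} (h : x ∈ altProd (FreeMonoid.of s) (FreeMonoid.of t) k) :
    x = s ∨ x = t := by
  induction k with
  | zero => exact absurd (altProd_zero (FreeMonoid.of s) (FreeMonoid.of t) ▸ h) FreeMonoid.notMem_one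
  | succ k ih =>
    rw [altProd_succ, FreeMonoid.mem_mul, ← altLetter_map FreeMonoid.of, FreeMonoid.mem_of] at h
    rcases h with h | rfl
    · exact ih h
    · exact altLetter_eq_or _ _ _

lemma left_right_mem_altProd (s t : S) {k : ℕ} (hk : 2 ≤ k) :
    s ∈ altProd (FreeMonoid.of s) (FreeMonoid.of t) k ∧
      t ∈ altProd (FreeMonoid.of s) (FreeMonoid.of t) k := by
  induction k, hk using Nat.le_induction with
  | base => simp [altProd, FreeMonoid.mem_mul]
  | succ k _ ih => simp [altProd_succ, FreeMonoid.mem_mul, ih]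

lemma mul_of_injective {u v : FreeMonoid S} {x y : S}
    (h : u * FreeMonoid.of x = v * FreeMonoid.of y) : u = v ∧ x = y := by
  obtain ⟨h1, h2⟩ := List.append_inj' (congrArg FreeMonoid.toList h) rfl
  exact ⟨h1, by simpa using h2⟩

lemma eq_one_or_eq_mul_of (u : FreeMonoid S) : u = 1 ∨ ∃ v x, u = v * FreeMonoid.of x := by
  rcases List.eq_nil_or_concat u.toList with h | ⟨v, x, h⟩
  · exact Or.inl h
  · exact Or.inr ⟨FreeMonoid.ofList v, x, by rw [← FreeMonoid.ofList_toList u, h]; simp⟩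

lemma length_mul_of (u : FreeMonoid S) (x : S) : (u * FreeMonoid.of x).length = u.length + 1 := by
  simp

end Words

/-! ### Words in Artin monoids -/

section ArtinMonoids

variable {S : Type u} (M : CoxeterMatrix S)

/-- The element of the Artin monoid represented by a word. -/
abbrev wordClass : FreeMonoid S →* ArtinMonoid M := PresentedMonoid.mk (ArtinRel M)

lemma wordClass_of (s : S) : wordClass M (FreeMonoid.of s) = gen M s := rfl

lemma wordClass_altProd (s t : S) (k : ℕ) :
    wordClass M (altProd (FreeMonoid.of s) (FreeMonoid.of t) k) = altProd (gen M s) (gen M t) k :=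
  map_altProd _ _ _ _

lemma exists_wordClass (α : ArtinMonoid M) : ∃ u, wordClass M u = α :=
  PresentedMonoid.surjective_mk α

lemma braid {s t : S} (h : M s t ≠ 0) :
    altProd (gen M s) (gen M t) (M s t) = altProd (gen M t) (gen M s) (M s t) := by
  rw [← wordClass_altProd, ← wordClass_altProd]
  exact PresentedMonoid.mk_eq_mk_of_rel (ArtinRel.braid s t h)

lemma two_le_of_ne {s t : S} (hst : s ≠ t) (h : M s t ≠ 0) : 2 ≤ M s t := by
  have := M.off_diagonal s t hst
  omega

variable {M} in
/-- Homomorphisms out of the Artin monoid. -/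
def liftHom {G : Type*} [Monoid G] (f : S → G)
    (hf : ∀ s t, M s t ≠ 0 → altProd (f s) (f t) (M s t) = altProd (f t) (f s) (M s t)) :
    ArtinMonoid M →* G :=
  PresentedMonoid.lift f (by
    rintro _ _ ⟨s, t, h⟩
    rw [map_altProd, map_altProd]
    exact hf s t h)

/-- The length homomorphism. -/
def lengthHom : ArtinMonoid M →* Multiplicative ℕ :=
  liftHom (fun _ => Multiplicative.ofAdd 1) fun _ _ _ => rfl

/-- The length of an element of the Artin monoid. -/
def len (α : ArtinMonoid M) : ℕ := (lengthHom M α).toAdd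

lemma len_gen (s : S) : len M (gen M s) = 1 := rfl

lemma len_one : len M 1 = 0 := by simp [len]

lemma len_mul (α β : ArtinMonoid M) : len M (α * β) = len M α + len M β := by simp [len]

lemma len_wordClass (u : FreeMonoid S) : len M (wordClass M u) = u.length := by
  induction u with
  | one => exact len_one M
  | of x => rfl
  | mul x y hx hy => rw [map_mul, len_mul, hx, hy, FreeMonoid.length_mul]

lemma length_eq_of_wordClass_eq {u v : FreeMonoid S} (h : wordClass M u = wordClass M v) :
    u.length = v.length := by
  rw [← len_wordClass M, h, len_wordClass]

lemma len_eq_zero {α : ArtinMonoid M} : len M α = 0 ↔ α = 1 := by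
  refine ⟨fun h => ?_, fun h => h ▸ len_one M⟩
  obtain ⟨u, rfl⟩ := exists_wordClass M α
  rw [len_wordClass, FreeMonoid.length_eq_zero] at h
  rw [h, map_one]

lemma gen_ne_one (s : S) : gen M s ≠ 1 := fun h => by
  simpa [h, len_one] using len_gen M s

lemma len_altProd (s t : S) (k : ℕ) : len M (altProd (gen M s) (gen M t) k) = k := by
  rw [← wordClass_altProd, len_wordClass, length_altProd]

/-- The homomorphism to `ℕ` that detects whether the generator `σ_r` occurs in an element. -/
def avoidHom (r : S) : ArtinMonoid M →* ℕ := by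
  classical
  exact liftHom (fun s => if s = r then 0 else 1) (by
    intro s t h
    by_cases hst : s = t
    · rw [hst]
    obtain ⟨k, hk⟩ := Nat.exists_eq_add_of_le' (two_le_of_ne M hst h)
    rw [hk]
    -- Both sides of a braid relation contain both letters because `M s t ≥ 2`, so both products
    -- vanish as soon as one letter is `r`. A word starting with the other letter needs two factors
    -- for this.
    have h0 : ∀ k, altProd (0 : ℕ) 1 (k + 1) = 0 := fun k => by
      induction k with
      | zero => simp [altProd_one]
      | succ k ih => rw [altProd_succ, ih, zero_mul]
    have h1 : ∀ k, altProd (1 : ℕ) 0 (k + 2) = 0 := fun k => by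
      induction k with
      | zero => simp [altProd]
      | succ k ih => rw [altProd_succ, ih, zero_mul]
    by_cases hs : s = r <;> by_cases ht : t = r
    · exact absurd (hs.trans ht.symm) hst
    all_goals simp only [hs, ht, if_true, if_false, h0, h1])

lemma avoidHom_gen_self (r : S) : avoidHom M r (gen M r) = 0 := if_pos rfl

lemma avoidHom_gen_of_ne {r s : S} (h : s ≠ r) : avoidHom M r (gen M s) = 1 := if_neg h

/-- A set of words that is closed under applying a braid relation to a subword is a union of classes
of words representing the same element. -/
lemma mem_of_wordClass_eq {D : Set (FreeMonoid S)}
    (hD : ∀ p q a b, a ≠ b → M a b ≠ 0 →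
      p * altProd (FreeMonoid.of a) (FreeMonoid.of b) (M a b) * q ∈ D →
      p * altProd (FreeMonoid.of b) (FreeMonoid.of a) (M a b) * q ∈ D)
    {u v : FreeMonoid S} (h : wordClass M u = wordClass M v) (hu : u ∈ D) : v ∈ D := by
  -- The contexts `p`, `q` make the claim stable under products in the generated congruence, and the
  -- equivalence makes it stable under symmetry.
  have key : ∀ p q, p * u * q ∈ D ↔ p * v * q ∈ D := by
    have h' : ConGen.Rel (ArtinRel M) u v := PresentedMonoid.mk_eq_mk_iff.1 h
    clear h hu
    induction h' with
    | of u v huv =>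
      obtain ⟨a, b, hab⟩ := huv
      intro p q
      by_cases hne : a = b
      · rw [hne]
      · refine ⟨hD p q a b hne hab, fun h => ?_⟩
        rw [M.symmetric a b] at h hab ⊢
        exact hD p q b a (Ne.symm hne) hab h
    | refl => exact fun _ _ => Iff.rfl
    | symm _ ih => exact fun p q => (ih p q).symm
    | trans _ _ ih1 ih2 => exact fun p q => (ih1 p q).trans (ih2 p q)
    | @mul w x y z _ _ ih1 ih2 =>
      intro p q
      have h1 := ih1 p (y * q)
      have h2 := ih2 (p * x) q
      simp only [mul_assoc] at h1 h2 ⊢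
      exact h1.trans h2
  simpa using (key 1 1).1 (by simpa using hu)

variable {s t : S}

/-- A braid relation that applies inside an alternating word in `s` and `t` is the one of `s` and
`t`. -/
lemma pair_of_subword {p q : FreeMonoid S} {a b s t : S} {k : ℕ} (hab : a ≠ b) (hm : M a b ≠ 0)
    (h : p * altProd (FreeMonoid.of a) (FreeMonoid.of b) (M a b) * q =
      altProd (FreeMonoid.of s) (FreeMonoid.of t) k) :
    ((a = s ∧ b = t) ∨ (a = t ∧ b = s)) ∧ p.length + M s t + q.length = k := by
  have h2 := two_le_of_ne M hab hm
  obtain ⟨ha, hb⟩ := left_right_mem_altProd a b h2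
  have hmem : ∀ x ∈ altProd (FreeMonoid.of a) (FreeMonoid.of b) (M a b), x = s ∨ x = t := by
    intro x hx
    refine mem_altProd (k := k) ?_
    rw [← h, FreeMonoid.mem_mul, FreeMonoid.mem_mul]
    exact Or.inl (Or.inr hx)
  have hl := congrArg FreeMonoid.length h
  rw [FreeMonoid.length_mul, FreeMonoid.length_mul, length_altProd, length_altProd] at hl
  rcases hmem a ha with rfl | rfl <;> rcases hmem b hb with rfl | rfl
  · exact absurd rfl hab
  · exact ⟨Or.inl ⟨rfl, rfl⟩, hl⟩
  · exact ⟨Or.inr ⟨rfl, rfl⟩, by rwa [M.symmetric]⟩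
  · exact absurd rfl hab

/-- A short alternating word is the only word representing its class. -/
lemma eq_altProd_of_lt {k : ℕ} (hk : k < M s t ∨ M s t = 0) {u : FreeMonoid S}
    (h : wordClass M u = altProd (gen M s) (gen M t) k) :
    u = altProd (FreeMonoid.of s) (FreeMonoid.of t) k := by
  rw [← wordClass_altProd] at h
  refine mem_of_wordClass_eq M (D := {altProd (FreeMonoid.of s) (FreeMonoid.of t) k}) ?_ h.symm rfl
  intro p q a b hab hm hmem
  obtain ⟨h1, h2⟩ := pair_of_subword M hab hm hmem
  have h3 : M s t ≠ 0 := by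
    rcases h1 with ⟨rfl, rfl⟩ | ⟨rfl, rfl⟩
    · exact hm
    · rwa [M.symmetric]
  omega

/-- Only the two alternating words represent `Δ_{s,t}`. -/
lemma eq_altProd_or (s t : S) {u : FreeMonoid S}
    (h : wordClass M u = altProd (gen M s) (gen M t) (M s t)) :
    u = altProd (FreeMonoid.of s) (FreeMonoid.of t) (M s t) ∨
      u = altProd (FreeMonoid.of t) (FreeMonoid.of s) (M s t) := by
  rw [← wordClass_altProd] at h
  refine mem_of_wordClass_eq M (D := {altProd (FreeMonoid.of s) (FreeMonoid.of t) (M s t),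
    altProd (FreeMonoid.of t) (FreeMonoid.of s) (M s t)}) ?_ h.symm (Or.inl rfl)
  rintro p q a b hab hm (hmem | hmem)
  · obtain ⟨h1, h2⟩ := pair_of_subword M hab hm hmem
    have hp : p = 1 := FreeMonoid.length_eq_zero.1 (by omega)
    -- The relation already has the full length `M s t`, so it fills the whole word and exchanges
    -- the two alternating words.
    have hq : q = 1 := FreeMonoid.length_eq_zero.1 (by omega)
    subst hp hq
    rcases h1 with ⟨rfl, rfl⟩ | ⟨rfl, rfl⟩
    · right; simp
    · left; simp [M.symmetric b a]
  · obtain ⟨h1, h2⟩ := pair_of_subword M hab hm hmem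
    rw [M.symmetric] at h2
    have hp : p = 1 := FreeMonoid.length_eq_zero.1 (by omega)
    have hq : q = 1 := FreeMonoid.length_eq_zero.1 (by omega)
    subst hp hq
    rcases h1 with ⟨rfl, rfl⟩ | ⟨rfl, rfl⟩
    · left; simp [M.symmetric b a]
    · right; simp

/-! ### Right divisors of alternating products -/

lemma gen_mem_rightDivisors_mul (α : ArtinMonoid M) (s : S) : s ∈ rightDivisors M (α * gen M s) :=
  ⟨α, rfl⟩

lemma rightDivisors_mul_subset (α β : ArtinMonoid M) :
    rightDivisors M β ⊆ rightDivisors M (α * β) := by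
  rintro s ⟨γ, rfl⟩
  exact ⟨α * γ, (mul_assoc _ _ _).symm⟩

/-- The alternating word is the only word for this element, so only its own last letter can be split
off. -/
lemma rightDivisors_altProd {k : ℕ} (hk : k + 1 < M s t) :
    rightDivisors M (altProd (gen M s) (gen M t) (k + 1)) = {altLetter s t k} := by
  refine Set.Subset.antisymm ?_ ?_
  · rintro r ⟨β, hβ⟩
    obtain ⟨u, rfl⟩ := exists_wordClass M β
    have h := eq_altProd_of_lt M (Or.inl hk) (u := u * FreeMonoid.of r)
      (by rw [map_mul, wordClass_of, hβ])
    rw [altProd_succ, ← altLetter_map FreeMonoid.of] at h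
    exact (mul_of_injective h).2
  · rintro _ rfl
    rw [altProd_succ, ← altLetter_map (gen M)]
    exact gen_mem_rightDivisors_mul _ _ _

/-- Right division of `Δ_{s,t}` by a generator. -/
lemma eq_of_mul_gen_eq_altProd (hst : s ≠ t) {k : ℕ} (hk : M s t = k + 1) {α : ArtinMonoid M}
    (h : α * gen M (altLetter s t k) = altProd (gen M s) (gen M t) (M s t)) :
    α = altProd (gen M s) (gen M t) k := by
  obtain ⟨u, rfl⟩ := exists_wordClass M α
  rw [← wordClass_of, ← map_mul] at h
  -- The two words for Δ end in different letters, so the last letter decides which one occurs;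
  -- general right cancellation is not needed.
  rcases eq_altProd_or M s t h with h | h
  · rw [hk, altProd_succ, ← altLetter_map FreeMonoid.of] at h
    rw [(mul_of_injective h).1, wordClass_altProd]
  · rw [hk, altProd_succ, ← altLetter_map FreeMonoid.of] at h
    exact absurd (mul_of_injective h).2 (altLetter_ne hst k)

end ArtinMonoids

section Dihedral

/-! ### Least common multiples in dihedral Artin monoids -/

variable {S : Type u} (M : CoxeterMatrix S)

/-- Cancels `c` letter by letter from the right. The bound on the total length keeps every use of
`H` below `n`, as the outer induction of `dihedral_reduction` requires. -/
lemma eq_of_mul_right_eq {n : ℕ}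
    (H : ∀ u v x, u.length < n → wordClass M (u * FreeMonoid.of x) = wordClass M (v * FreeMonoid.of x)
      → wordClass M u = wordClass M v) (c : FreeMonoid S) :
    ∀ u v : FreeMonoid S, u.length + c.length ≤ n →
      wordClass M (u * c) = wordClass M (v * c) → wordClass M u = wordClass M v := by
  induction c using FreeMonoid.inductionOn' with
  | one => intro u v _ h; simpa using h
  | of_mul x c ih =>
    intro u v hl h
    simp only [FreeMonoid.length_mul, FreeMonoid.length_of] at hl
    rw [← mul_assoc, ← mul_assoc] at h
    exact H u v x (by omega) (ih _ _ (by rw [length_mul_of]; omega) h)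

/-- If two words in the two generators `s`, `t` represent the same element, then either they end in
the same letter and the remaining words represent the same element, or the element is a left
multiple of `Δ_{s,t}`. Here `c x` is a word such that `c x` followed by `x` represents
`Δ_{s,t}`. -/
lemma dihedral_reduction (hall : ∀ x y z : S, x ≠ y → y ≠ z → x = z) (c : S → FreeMonoid S)
    (hc : ∀ a b, a ≠ b → M a b ≠ 0 → altProd (FreeMonoid.of a) (FreeMonoid.of b) (M a b) =
      c (altLetter a b (M a b - 1)) * FreeMonoid.of (altLetter a b (M a b - 1)))
    (n : ℕ) : ∀ u v : FreeMonoid S, ∀ x y, u.length ≤ n →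
      wordClass M (u * FreeMonoid.of x) = wordClass M (v * FreeMonoid.of y) →
      (x = y → wordClass M u = wordClass M v) ∧
      (x ≠ y → ∃ w, wordClass M u = wordClass M (w * c x) ∧
        wordClass M v = wordClass M (w * c y)) := by
  induction n using Nat.strong_induction_on with
  | _ n IH =>
  -- The outer induction on the length supplies cancellation for shorter words; the inner induction
  -- follows the derivation of the equality.
  have cancel := eq_of_mul_right_eq M (n := n) fun u v x hl h => (IH _ hl u v x x le_rfl h).1 rfl
  intro u v x y hl h
  have h' : ConGen.Rel (ArtinRel M) (u * FreeMonoid.of x) (v * FreeMonoid.of y) :=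
    PresentedMonoid.mk_eq_mk_iff.1 h
  clear h
  generalize hU : u * FreeMonoid.of x = U at h'
  generalize hV : v * FreeMonoid.of y = V at h'
  induction h' generalizing u v x y with
  | of U V hr =>
    obtain ⟨a, b, hab⟩ := hr
    by_cases hne : a = b
    · subst hne
      obtain ⟨rfl, rfl⟩ := mul_of_injective (hU.trans hV.symm)
      exact ⟨fun _ => rfl, fun h => absurd rfl h⟩
    · have hba : M b a ≠ 0 := by rwa [M.symmetric]
      rw [hc a b hne hab] at hU
      rw [M.symmetric a b, hc b a (Ne.symm hne) hba, M.symmetric b a] at hV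
      obtain ⟨rfl, rfl⟩ := mul_of_injective hU
      obtain ⟨rfl, rfl⟩ := mul_of_injective hV
      exact ⟨fun h => absurd h (altLetter_ne hne _), fun _ => ⟨1, by simp, by simp⟩⟩
  | refl =>
    obtain ⟨rfl, rfl⟩ := mul_of_injective (hU.trans hV.symm)
    exact ⟨fun _ => rfl, fun h => absurd rfl h⟩
  | @symm U V hr ih =>
    have hUV := length_eq_of_wordClass_eq M (PresentedMonoid.mk_eq_mk_iff.2 hr)
    rw [← hU, ← hV, length_mul_of, length_mul_of] at hUV
    obtain ⟨h1, h2⟩ := ih v u y x (by omega) hV hU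
    refine ⟨fun h => (h1 h.symm).symm, fun h => ?_⟩
    obtain ⟨w, hw1, hw2⟩ := h2 h.symm
    exact ⟨w, hw2, hw1⟩
  | @trans U W V hr1 hr2 ih1 ih2 =>
    have hUW := length_eq_of_wordClass_eq M (PresentedMonoid.mk_eq_mk_iff.2 hr1)
    rcases eq_one_or_eq_mul_of W with rfl | ⟨w, z, rfl⟩
    · rw [← hU, length_mul_of, FreeMonoid.length_one] at hUW
      exact absurd hUW (Nat.succ_ne_zero _)
    rw [← hU, length_mul_of, length_mul_of] at hUW
    obtain ⟨h1, h1'⟩ := ih1 u w x z hl hU rfl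
    obtain ⟨h2, h2'⟩ := ih2 w v z y (by omega) rfl hV
    by_cases hxz : x = z
    · subst hxz
      rw [h1 rfl]
      exact ⟨h2, h2'⟩
    by_cases hzy : z = y
    · subst hzy
      rw [← h2 rfl]
      exact ⟨h1, h1'⟩
    -- With two letters, a middle word ending differently from both outer words forces `x = y`. Then
    -- `w` equals both `w1 * c z` and `w2 * c z` in the monoid, and cancelling `c z` identifies `w1`
    -- with `w2`.
    have hxy := hall x z y hxz hzy
    subst hxy
    refine ⟨fun _ => ?_, fun h => absurd rfl h⟩
    obtain ⟨w1, hw1, hw1'⟩ := h1' hxz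
    obtain ⟨w2, hw2, hw2'⟩ := h2' hzy
    have hw := hw1'.symm.trans hw2
    have hlw := length_eq_of_wordClass_eq M hw1'
    rw [FreeMonoid.length_mul] at hlw
    rw [hw1, hw2', map_mul, map_mul, cancel _ w1 w2 (by omega) hw]
  | @mul U1 V1 U2 V2 hr1 hr2 ih1 ih2 =>
    have hl2 := length_eq_of_wordClass_eq M (PresentedMonoid.mk_eq_mk_iff.2 hr2)
    have hc1 : wordClass M U1 = wordClass M V1 := PresentedMonoid.mk_eq_mk_iff.2 hr1
    -- The last letters lie in the right factors unless these are empty; relations preserve length,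
    -- so they are empty together.
    rcases eq_one_or_eq_mul_of U2 with rfl | ⟨u2, x', rfl⟩
    · have hV2 : V2 = 1 := FreeMonoid.length_eq_zero.1 (by rw [← hl2, FreeMonoid.length_one])
      subst hV2
      rw [mul_one] at hU hV
      exact ih1 u v x y hl hU hV
    · rcases eq_one_or_eq_mul_of V2 with rfl | ⟨v2, y', rfl⟩
      · rw [length_mul_of, FreeMonoid.length_one] at hl2
        exact absurd hl2 (Nat.succ_ne_zero _)
      rw [← mul_assoc] at hU hV
      obtain ⟨rfl, rfl⟩ := mul_of_injective hU
      obtain ⟨rfl, rfl⟩ := mul_of_injective hV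
      rw [FreeMonoid.length_mul] at hl
      obtain ⟨h1, h2⟩ := ih2 u2 v2 x y (by omega) rfl rfl
      refine ⟨fun h => ?_, fun h => ?_⟩
      · rw [map_mul, map_mul, hc1, h1 h]
      · obtain ⟨w, hw, hw'⟩ := h2 h
        exact ⟨V1 * w, by rw [map_mul, hw, hc1, mul_assoc, ← map_mul],
          by rw [map_mul, hw', mul_assoc, ← map_mul]⟩

/-- A common left multiple has words `u s` and `v t` with different last letters, so
`dihedral_reduction` splits off Δ on the right. -/
lemma isLeastLeftCommonMultiple_pair {s t : S} (hst : s ≠ t) (hm : M s t ≠ 0)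
    (hall : ∀ x, x = s ∨ x = t) :
    IsLeastLeftCommonMultiple (Set.range (gen M)) (altProd (gen M s) (gen M t) (M s t)) := by
  classical
  obtain ⟨k, hk⟩ := Nat.exists_eq_add_of_le' ((by omega : 1 ≤ 2).trans (two_le_of_ne M hst hm))
  have hts : altProd (gen M s) (gen M t) (M s t) = altProd (gen M t) (gen M s) (M s t) := braid M hm
  let c : S → FreeMonoid S := fun x => if x = altLetter s t k then
    altProd (FreeMonoid.of s) (FreeMonoid.of t) k else altProd (FreeMonoid.of t) (FreeMonoid.of s) k
  have hcs : c (altLetter s t k) = altProd (FreeMonoid.of s) (FreeMonoid.of t) k := if_pos rfl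
  have hct : c (altLetter t s k) = altProd (FreeMonoid.of t) (FreeMonoid.of s) k :=
    if_neg (altLetter_ne hst k).symm
  have hcΔ : ∀ x, altProd (gen M s) (gen M t) (M s t) = wordClass M (c x) * gen M x := by
    intro x
    rcases eq_altLetter_or (hall x) k with rfl | rfl
    · rw [hk, altProd_succ, hcs, wordClass_altProd, altLetter_map (gen M)]
    · rw [hts, hk, altProd_succ, hct, wordClass_altProd, altLetter_map (gen M)]
  refine ⟨?_, fun β hβ => ?_⟩
  · rintro _ ⟨x, rfl⟩
    exact ⟨_, hcΔ x⟩
  · obtain ⟨γ, hγ⟩ := hβ _ ⟨s, rfl⟩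
    obtain ⟨γ', hγ'⟩ := hβ _ ⟨t, rfl⟩
    obtain ⟨u, rfl⟩ := exists_wordClass M γ
    obtain ⟨v, rfl⟩ := exists_wordClass M γ'
    have h := (dihedral_reduction M (c := c) (fun x y z hxy hyz => by
      rcases hall x with rfl | rfl <;> rcases hall y with rfl | rfl <;>
        rcases hall z with rfl | rfl <;> simp_all) (fun a b hab hab' => by
      have hcase : (a = s ∧ b = t) ∨ (a = t ∧ b = s) := by
        rcases hall a with rfl | rfl <;> rcases hall b with rfl | rfl <;> simp_all
      rcases hcase with ⟨rfl, rfl⟩ | ⟨rfl, rfl⟩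
      · rw [hk, altProd_succ, Nat.add_sub_cancel, hcs, altLetter_map FreeMonoid.of]
      · rw [M.symmetric, hk, altProd_succ, Nat.add_sub_cancel, hct, altLetter_map FreeMonoid.of])
      u.length u v s t le_rfl (by rw [map_mul, map_mul]; exact hγ.symm.trans hγ')).2 hst
    obtain ⟨w, hw, -⟩ := h
    refine ⟨wordClass M w, ?_⟩
    rw [hγ, hw, hcΔ s, map_mul, mul_assoc]

/-- Each is a left multiple of the other, and additivity of the length makes the quotient trivial.
-/
lemma isLeastLeftCommonMultiple_unique {E : Set (ArtinMonoid M)} {δ δ' : ArtinMonoid M}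
    (h : IsLeastLeftCommonMultiple E δ) (h' : IsLeastLeftCommonMultiple E δ') : δ = δ' := by
  obtain ⟨γ, hγ⟩ := h'.2 δ h.1
  obtain ⟨γ', hγ'⟩ := h.2 δ' h'.1
  have h1 := congrArg (len M) hγ
  have h2 := congrArg (len M) hγ'
  rw [len_mul] at h1 h2
  have h3 : γ = 1 := (len_eq_zero M).1 (by omega)
  rw [hγ, h3, one_mul]

end Dihedral

/-! ### The elements `Δ_T` -/

section Delta

/-- The group is dihedral: the finite cyclic group `N` generated by `a * b` together with the coset
`N a` is stable under right multiplication by `a` and `b`. -/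
lemma finite_closure_pair {G : Type*} [Group G] {a b : G} (ha : a * a = 1) (hb : b * b = 1)
    {m : ℕ} (hm : m ≠ 0) (hab : (a * b) ^ m = 1) : Finite (Subgroup.closure {a, b}) := by
  have hfin : Finite (Subgroup.zpowers (a * b)) :=
    finite_zpowers.2 (isOfFinOrder_iff_pow_eq_one.2 ⟨m, Nat.pos_of_ne_zero hm, hab⟩)
  have ha' : a⁻¹ = a := inv_eq_of_mul_eq_one_left ha
  have hb' : b⁻¹ = b := inv_eq_of_mul_eq_one_left hb
  have hba : (b * a) ∈ Subgroup.zpowers (a * b) := by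
    have : b * a = (a * b)⁻¹ := by rw [mul_inv_rev, ha', hb']
    rw [this]
    exact Subgroup.inv_mem _ (Subgroup.mem_zpowers _)
  let N : Set G := Subgroup.zpowers (a * b)
  have hsub : (Subgroup.closure {a, b} : Set G) ⊆ N ∪ (fun x => x * a) '' N := by
    intro x hx
    have hmul : ∀ x ∈ N ∪ (fun x => x * a) '' N, ∀ y ∈ ({a, b} : Set G),
        x * y ∈ N ∪ (fun x => x * a) '' N := by
      rintro x (hx | ⟨x, hx, rfl⟩) y (rfl | rfl)
      · exact Or.inr ⟨x, hx, rfl⟩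
      · exact Or.inr ⟨x * (y * a), Subgroup.mul_mem _ hx hba, by simp [mul_assoc, ha]⟩
      · exact Or.inl (by simpa [mul_assoc, ha] using hx)
      · exact Or.inl (by
          rw [mul_assoc]
          exact Subgroup.mul_mem _ hx (Subgroup.mem_zpowers _))
    induction hx using Subgroup.closure_induction_right with
    | one => exact Or.inl (Subgroup.one_mem _)
    | mul_right x _ y hy ih => exact hmul x ih y hy
    | mul_inv_cancel x _ y hy ih =>
      have : y⁻¹ = y := by
        rcases hy with rfl | rfl
        exacts [ha', hb']
      rw [this]
      exact hmul x ih y hy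
  have hN : N.Finite := hfin
  exact (hN.union (hN.image _)).subset hsub

variable {S : Type u} (M : CoxeterMatrix S)

lemma isFiniteType_pair {s t : S} (hm : M s t ≠ 0) : IsFiniteType M {s, t} := by
  unfold IsFiniteType
  rw [Set.image_pair]
  exact finite_closure_pair (M.toCoxeterSystem.simple_mul_simple_self s)
    (M.toCoxeterSystem.simple_mul_simple_self t) hm (M.toCoxeterSystem.simple_mul_simple_pow s t)

lemma isFiniteType_singleton (s : S) : IsFiniteType M {s} := by
  have := isFiniteType_pair M (s := s) (t := s) (by simp)
  rwa [Set.pair_eq_singleton] at this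

lemma isFiniteType_empty : IsFiniteType M ∅ := by
  unfold IsFiniteType
  rw [Set.image_empty, Subgroup.closure_empty]
  infer_instance

lemma inclusion_gen (T : Set S) (s : T) : inclusion M T (gen (restrict M T) s) = gen M s := rfl

lemma isDelta_empty : IsDelta M ∅ 1 :=
  ⟨isFiniteType_empty M, 1, ⟨by rintro _ ⟨⟨x, hx⟩, -⟩; exact hx.elim, fun β _ => ⟨β, by simp⟩⟩,
    map_one (inclusion M ∅)⟩

lemma isDelta_singleton (s : S) : IsDelta M {s} (gen M s) := by
  refine ⟨isFiniteType_singleton M s, gen _ ⟨s, rfl⟩, ⟨?_, fun β hβ => hβ _ ⟨_, rfl⟩⟩, rfl⟩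
  rintro _ ⟨⟨x, rfl⟩, rfl⟩
  exact ⟨1, (one_mul _).symm⟩

lemma isDelta_pair {s t : S} (hst : s ≠ t) (hm : M s t ≠ 0) :
    IsDelta M {s, t} (altProd (gen M s) (gen M t) (M s t)) := by
  refine ⟨isFiniteType_pair M hm, _, isLeastLeftCommonMultiple_pair (restrict M {s, t})
    (s := ⟨s, by simp⟩) (t := ⟨t, by simp⟩) (by simpa using hst) hm ?_, ?_⟩
  · rintro ⟨x, rfl | rfl⟩ <;> simp
  · rw [map_altProd, inclusion_gen, inclusion_gen]
    rfl

variable {M} {T T' : Set S} {α α' : ArtinMonoid M}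

lemma IsDelta.eq (h : IsDelta M T α) (h' : IsDelta M T α') : α = α' := by
  obtain ⟨-, δ, hδ, rfl⟩ := h
  obtain ⟨-, δ', hδ', rfl⟩ := h'
  rw [isLeastLeftCommonMultiple_unique _ hδ hδ']

/-- The right divisors of `Δ_T` are the elements of `T`. -/
lemma IsDelta.rightDivisors_eq (h : IsDelta M T α) : rightDivisors M α = T := by
  obtain ⟨-, δ, hδ, rfl⟩ := h
  ext s
  constructor
  · rintro ⟨β, hβ⟩
    by_contra hs
    -- No generator from `T` is `σ_s`, so `avoidHom M s` is 1 on the image of `A_T⁺`, but it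
    -- vanishes on every multiple of `σ_s`.
    have h1 : (avoidHom M s).comp (inclusion M T) = 1 := by
      refine PresentedMonoid.ext _ fun x => ?_
      exact avoidHom_gen_of_ne M fun hx => hs (hx ▸ x.2)
    have h2 := DFunLike.congr_fun h1 δ
    rw [MonoidHom.comp_apply, hβ, map_mul, avoidHom_gen_self, mul_zero] at h2
    exact zero_ne_one h2
  · intro hs
    obtain ⟨γ, hγ⟩ := hδ.1 _ ⟨⟨s, hs⟩, rfl⟩
    exact ⟨inclusion M T γ, by rw [hγ, map_mul, inclusion_gen]⟩

lemma IsDelta.set_eq (h : IsDelta M T α) (h' : IsDelta M T' α) : T = T' :=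
  h.rightDivisors_eq.symm.trans h'.rightDivisors_eq

end Delta

/-! ### Curves in the collapsed complex -/

lemma continuous_cellMap (X : SSet.{u}) {n : ℕ} (x : X.obj (.op (SimplexCategory.mk n))) :
    Continuous (cellMap X x) := by
  unfold cellMap
  exact (ConcreteCategory.hom (SSet.toTopSimplex.inv.app (SimplexCategory.mk n) ≫
    SSet.toTop.map (SSet.yonedaEquiv.symm x))).continuous.comp continuous_uliftUp

/-- Naturality of the Yoneda correspondence and of the identification of the realized simplex with
the standard one. -/
lemma cellMap_map (X : SSet.{u}) {m n : ℕ} (f : SimplexCategory.mk m ⟶ SimplexCategory.mk n)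
    (x : X.obj (.op (SimplexCategory.mk n))) (p : stdSimplex ℝ (Fin (m + 1))) :
    cellMap X (X.map f.op x) p = cellMap X x (stdSimplex.map f.toOrderHom p) := by
  change SSet.toTop.map (SSet.yonedaEquiv.symm (X.map f.op x))
      ((SimplexCategory.mk m).toTopHomeo.symm p) =
    SSet.toTop.map (SSet.yonedaEquiv.symm x)
      ((SimplexCategory.mk n).toTopHomeo.symm (stdSimplex.map f.toOrderHom p))
  have h := SimplexCategory.toTopHomeo_symm_naturality_apply f p
  refine Eq.trans ?_ (congrArg (SSet.toTop.map (SSet.yonedaEquiv.symm x)) h).symm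
  rw [← SSet.yonedaEquiv_symm_naturality_left, Functor.map_comp]
  rfl

lemma bar_map_succ {G : Type u} [Monoid G] {n : ℕ} (x : Fin n → G) (i : ℕ) (hi : i < n) :
    ComposableArrows.map' (bar x) i (i + 1) = MulOpposite.op (x ⟨i, hi⟩) :=
  ComposableArrows.mkOfObjOfMapSucc_map_succ _ _ i hi

lemma eq_bar_one {G : Type u} [Monoid G]
    (F : (BarComplex G).obj (.op (SimplexCategory.mk 1))) (x : G)
    (h : ComposableArrows.map' F 0 1 = MulOpposite.op x) : F = bar ![x] := by
  refine ComposableArrows.ext₁ rfl rfl ?_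
  erw [Category.id_comp, Category.comp_id]
  exact h.trans (bar_map_succ ![x] 0 one_pos).symm

lemma eq_bar_zero {G : Type u} [Monoid G]
    (F : (BarComplex G).obj (.op (SimplexCategory.mk 0))) (x : Fin 0 → G) : F = bar x :=
  ComposableArrows.ext₀ rfl

lemma face_zero_bar {G : Type u} [Monoid G] (x y : G) :
    (BarComplex G).map (SimplexCategory.δ (0 : Fin 3)).op (bar ![x, y]) = bar ![y] :=
  eq_bar_one _ _ (bar_map_succ ![x, y] 1 one_lt_two)

lemma face_two_bar {G : Type u} [Monoid G] (x y : G) :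
    (BarComplex G).map (SimplexCategory.δ (2 : Fin 3)).op (bar ![x, y]) = bar ![x] :=
  eq_bar_one _ _ (bar_map_succ ![x, y] 0 two_pos)

lemma face_one_bar {G : Type u} [Monoid G] (x y : G) :
    (BarComplex G).map (SimplexCategory.δ (1 : Fin 3)).op (bar ![x, y]) = bar ![x * y] := by
  refine eq_bar_one _ _ ?_
  have h1 : ComposableArrows.map' (n := 2) (bar ![x, y]) 0 1 = MulOpposite.op x :=
    bar_map_succ ![x, y] 0 two_pos
  have h2 : ComposableArrows.map' (n := 2) (bar ![x, y]) 1 2 = MulOpposite.op y :=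
    bar_map_succ ![x, y] 1 one_lt_two
  have h := ComposableArrows.map'_comp
    (bar ![x, y] : ComposableArrows (SingleObj Gᵐᵒᵖ) 2) 0 1 2
  rw [h1, h2] at h
  exact h

lemma map_simplexEdge {m n : ℕ} (f : Fin m → Fin n) (i j : Fin m) (τ : unitInterval) :
    stdSimplex.map f (simplexEdge i j τ) = simplexEdge (f i) (f j) τ := by
  refine stdSimplex.ext ?_
  rw [stdSimplex.map_coe]
  change FunOnFinite.linearMap ℝ ℝ f
      (AffineMap.lineMap (Pi.single i 1 : Fin m → ℝ) (Pi.single j 1) (τ : ℝ)) =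
    AffineMap.lineMap (Pi.single (f i) 1 : Fin n → ℝ) (Pi.single (f j) 1) (τ : ℝ)
  simp [AffineMap.lineMap_apply, FunOnFinite.linearMap_piSingle]

/-- At `τ` the edge has coordinates `(1 - τ, 0, τ)`. Subtracting the minimum from the outer two and
adding twice it to the middle one gives `(1 - 2τ, 2τ, 0)` on the first half and `(0, 2 - 2τ, 2τ -
1)` on the second, the double-speed parametrization of `Path.trans`. -/
lemma hornRetraction_simplexEdge (τ : unitInterval) :
    hornRetraction 1 (simplexEdge (0 : Fin 3) 2 τ) =
      ((simplexEdge (0 : Fin 3) 1).trans (simplexEdge 1 2)) τ := by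
  have hp : ∀ (i j : Fin 3) (σ : unitInterval) (k : Fin 3), simplexEdge i j σ k =
      (1 - (σ : ℝ)) * (Pi.single i 1 : Fin 3 → ℝ) k + σ * (Pi.single j 1 : Fin 3 → ℝ) k := by
    intro i j σ k
    change AffineMap.lineMap (Pi.single i 1 : Fin 3 → ℝ) (Pi.single j 1) (σ : ℝ) k = _
    simp [AffineMap.lineMap_apply_module]
  have hinf : (⨅ k : {k : Fin 3 // k ≠ 1}, simplexEdge (0 : Fin 3) 2 τ k) =
      min (1 - (τ : ℝ)) τ := by
    refine le_antisymm (le_min ?_ ?_) ?_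
    · refine (ciInf_le (Set.finite_range _).bddBelow ⟨0, by decide⟩).trans_eq ?_
      simp [hp]
    · refine (ciInf_le (Set.finite_range _).bddBelow ⟨2, by decide⟩).trans_eq ?_
      simp [hp]
    · have : Nonempty {k : Fin 3 // k ≠ 1} := ⟨⟨0, by decide⟩⟩
      refine le_ciInf fun ⟨k, hk⟩ => ?_
      fin_cases k
      · simp [hp]
      · exact absurd rfl hk
      · simp [hp]
  refine stdSimplex.ext (funext fun k => ?_)
  change (if k = 1 then simplexEdge (0 : Fin 3) 2 τ 1 + ((1 : ℕ) + 1) *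
      ⨅ k : {k : Fin 3 // k ≠ 1}, simplexEdge (0 : Fin 3) 2 τ k
    else simplexEdge (0 : Fin 3) 2 τ k - ⨅ k : {k : Fin 3 // k ≠ 1},
      simplexEdge (0 : Fin 3) 2 τ k) = _
  rw [hinf, Path.trans_apply]
  split_ifs with hk hτ hτ
  · subst hk
    rw [min_eq_right (by linarith), hp, hp]
    simp only [Nat.cast_one, one_add_one_eq_two]
    simp
  · subst hk
    rw [min_eq_left (by linarith), hp, hp]
    simp
    ring
  · rw [min_eq_right (by linarith), hp, hp]
    fin_cases k
    · simp
      ring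
    · exact absurd rfl hk
    · simp
  · rw [min_eq_left (by linarith), hp, hp]
    fin_cases k
    · simp
    · exact absurd rfl hk
    · simp
      ring

/-! ### Edges and triangles of `Y` as curves -/

section Curves

variable {S : Type u} [LinearOrder S] (M : CoxeterMatrix S)

lemma continuous_charMap {n : ℕ} (c : Fin n → ArtinMonoid M) : Continuous (charMap M c) :=
  continuous_quot_mk.comp (continuous_cellMap _ _)

/-- The vertex of `Y`. -/
def baseVertex : Y M := charMap M ![] (stdSimplex.vertex 0)

lemma charMap_face {m n : ℕ} (f : SimplexCategory.mk m ⟶ SimplexCategory.mk n)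
    (c : Fin n → ArtinMonoid M) (d : Fin m → ArtinMonoid M)
    (h : (BarComplex (ArtinMonoid M)).map f.op (bar c) = bar d) (p : stdSimplex ℝ (Fin (m + 1))) :
    charMap M d p = charMap M c (stdSimplex.map f.toOrderHom p) := by
  unfold charMap
  rw [← h, cellMap_map]

/-- The classifying space has a single 0-simplex, so every edge closes up to a loop. -/
lemma charMap_vertex {n : ℕ} (c : Fin n → ArtinMonoid M) (i : Fin (n + 1)) :
    charMap M c (stdSimplex.vertex i) = baseVertex M := by
  unfold baseVertex
  rw [charMap_face M (SimplexCategory.const _ _ i) c ![] (eq_bar_zero _ _), stdSimplex.map_vertex]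
  rfl

lemma charMap_pair_zero_one (x y : ArtinMonoid M) (τ : unitInterval) :
    charMap M ![x, y] (simplexEdge 0 1 τ) = edgeCurve M x τ := by
  unfold edgeCurve
  rw [charMap_face M _ _ _ (face_two_bar x y), map_simplexEdge]
  rfl

lemma charMap_pair_one_two (x y : ArtinMonoid M) (τ : unitInterval) :
    charMap M ![x, y] (simplexEdge 1 2 τ) = edgeCurve M y τ := by
  unfold edgeCurve
  rw [charMap_face M _ _ _ (face_zero_bar x y), map_simplexEdge]
  rfl

lemma charMap_pair_zero_two (x y : ArtinMonoid M) (τ : unitInterval) :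
    charMap M ![x, y] (simplexEdge 0 2 τ) = edgeCurve M (x * y) τ := by
  unfold edgeCurve
  rw [charMap_face M _ _ _ (face_one_bar x y), map_simplexEdge]
  rfl

/-- The edge `[x]` as a loop in `Y`. -/
def edgeLoop (x : ArtinMonoid M) : Path (baseVertex M) (baseVertex M) where
  toFun := edgeCurve M x
  continuous_toFun := (continuous_charMap M _).comp (simplexEdge 0 1).continuous
  source' := by
    unfold edgeCurve
    rw [(simplexEdge 0 1).source, charMap_vertex]
  target' := by
    unfold edgeCurve
    rw [(simplexEdge 0 1).target, charMap_vertex]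

lemma edgeLoop_apply (x : ArtinMonoid M) (τ : unitInterval) :
    edgeLoop M x τ = edgeCurve M x τ := rfl

lemma simplexEdge_symm_apply {n : ℕ} (i j : Fin n) (τ : unitInterval) :
    simplexEdge i j (unitInterval.symm τ) = simplexEdge j i τ := by
  refine stdSimplex.ext ?_
  exact AffineMap.lineMap_apply_one_sub _ _ _

/-- If `[x|y]` is matched with `[xy]`, then the edge `[xy]` is collapsed onto `[x]` followed by
`[y]`. -/
lemma edgeLoop_mul_of_isMatched {x y : ArtinMonoid M} (h : IsMatched M [x, y] 1) :
    edgeLoop M (x * y) = (edgeLoop M x).trans (edgeLoop M y) := by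
  ext τ
  rw [edgeLoop_apply, ← charMap_pair_zero_two]
  have hP : (⟨1, bar ![x, y], 1⟩ : Σ n : ℕ, (BarComplex (ArtinMonoid M)).obj
      (.op (SimplexCategory.mk (n + 1))) × Fin (n + 2)) ∈ artinMatching M :=
    ⟨![x, y], rfl, by simpa using h⟩
  have h1 : charMap M ![x, y] (simplexEdge 0 2 τ) =
      charMap M ![x, y] (hornRetraction 1 (simplexEdge (0 : Fin 3) 2 τ)) :=
    Quot.sound (CollapseRel.collapse 1 _ 1 hP _)
  rw [h1, hornRetraction_simplexEdge, Path.trans_apply, Path.trans_apply]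
  split_ifs
  · exact charMap_pair_zero_one M x y _
  · exact charMap_pair_one_two M x y _

/-- The boundary curve of `[x|y]` runs through `[x]`, `[y]` and the inverse of `[xy]`. -/
lemma boundaryCurve_eq (x y : ArtinMonoid M) (τ : unitInterval) :
    boundaryCurve M x y τ =
      (((edgeLoop M x).trans (edgeLoop M y)).trans (edgeLoop M (x * y)).symm) τ := by
  unfold boundaryCurve triangleBoundary
  simp only [Path.trans_apply]
  split_ifs
  · exact charMap_pair_zero_one M x y _
  · exact charMap_pair_one_two M x y _
  -- The third side runs from vertex 2 to vertex 0, against the direction of the edge `[xy]`.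
  · rw [← simplexEdge_symm_apply]
    exact charMap_pair_zero_two M x y _

end Curves

section Loops

variable {X : Type*} [TopologicalSpace X] {v : X}

lemma loopClass_trans (γ γ' : Path v v) :
    loopClass (γ.trans γ') = loopClass γ * loopClass γ' := rfl

lemma loopClass_symm (γ : Path v v) : loopClass γ.symm = (loopClass γ)⁻¹ := rfl

end Loops

/-! ### Essential and matched cells -/

section Cells

variable {S : Type u} {M : CoxeterMatrix S}

lemma isMu1Essential_nil : IsMu1Essential M [] :=
  ⟨by simp [IsCell], fun k hk => absurd hk (Nat.not_lt_zero k)⟩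

lemma isMu1Essential_cons {x : ArtinMonoid M} {c : List (ArtinMonoid M)} {T : Set S} (hx : x ≠ 1)
    (hT : T.Nonempty) (hΔ : IsDelta M T (x * c.prod)) (hc : IsMu1Essential M c) :
    IsMu1Essential M (x :: c) := by
  refine ⟨List.forall_mem_cons.2 ⟨hx, hc.1⟩, fun k hk => ?_⟩
  cases k with
  | zero => exact ⟨T, hT, by simpa using hΔ⟩
  | succ k => exact hc.2 k (Nat.lt_of_succ_lt_succ hk)

lemma isMu1Essential_singleton_gen (s : S) : IsMu1Essential M [gen M s] :=
  isMu1Essential_cons (gen_ne_one M s) (Set.singleton_nonempty s)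
    (by simpa using isDelta_singleton M s) isMu1Essential_nil

lemma depth1_eq_zero {c : List (ArtinMonoid M)} (h : IsMu1Essential M c) : depth1 M c = 0 :=
  Nat.sInf_eq_zero.2 (Or.inl h)

lemma sInf_eq_one {A : Set ℕ} (h0 : 0 ∉ A) (h1 : 1 ∈ A) : sInf A = 1 := by
  have h2 : sInf A ∈ A := Nat.sInf_mem ⟨1, h1⟩
  have h3 : sInf A ≤ 1 := Nat.sInf_le h1
  have h4 : sInf A ≠ 0 := fun h => h0 (h ▸ h2)
  omega

lemma pair_diff_right {p q : S} (h : p ≠ q) : ({p, q} : Set S) \ {q} = {p} := by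
  ext x
  simp only [Set.mem_sdiff, Set.mem_insert_iff, Set.mem_singleton_iff]
  constructor
  · rintro ⟨h1 | h1, h2⟩
    exacts [h1, absurd h1 h2]
  · rintro rfl
    exact ⟨Or.inl rfl, h⟩

lemma mul_ne_gen {x y : ArtinMonoid M} (hx : x ≠ 1) (hy : y ≠ 1) (s : S) : x * y ≠ gen M s := by
  intro h
  have h1 := congrArg (len M) h
  rw [len_mul, len_gen] at h1
  rw [Ne, ← len_eq_zero] at hx hy
  omega

lemma altProd_mul_gen_comm {s t : S} {k : ℕ} (hk : M s t = k + 1) :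
    altProd (gen M t) (gen M s) k * gen M (altLetter t s k) =
      altProd (gen M s) (gen M t) k * gen M (altLetter s t k) := by
  have h := braid M (s := s) (t := t) (by omega)
  rw [hk, altProd_succ, altProd_succ, ← altLetter_map (gen M), ← altLetter_map (gen M)] at h
  exact h.symm

lemma isDelta_altProd {s t : S} (hst : s ≠ t) {k : ℕ} (hk : M s t = k + 1) :
    IsDelta M {altLetter s t k, altLetter t s k}
      (altProd (gen M s) (gen M t) k * gen M (altLetter s t k)) := by
  have h := isDelta_pair M hst (by omega)
  rw [hk, altProd_succ, ← altLetter_map (gen M)] at h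
  have h' : ({altLetter s t k, altLetter t s k} : Set S) = {s, t} := by
    unfold altLetter
    split_ifs
    exacts [rfl, Set.pair_comm _ _]
  rwa [h']

variable [LinearOrder S]

lemma isMu2Essential_nil : IsMu2Essential M [] :=
  ⟨isMu1Essential_nil, fun k hk => absurd hk (Nat.not_lt_zero k)⟩

lemma isMu2Essential_cons {x : ArtinMonoid M} {c : List (ArtinMonoid M)} {T T' : Set S} {s : S}
    (hx : x ≠ 1) (hΔ : IsDelta M T (x * c.prod)) (hΔ' : IsDelta M T' c.prod) (hs : T \ T' = {s})
    (hmax : IsGreatest T s) (hc : IsMu2Essential M c) : IsMu2Essential M (x :: c) := by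
  refine ⟨isMu1Essential_cons hx ⟨s, hmax.1⟩ hΔ hc.1, fun k hk => ?_⟩
  cases k with
  | zero => exact ⟨T, T', s, by simpa using hΔ, by simpa using hΔ', hs, hmax⟩
  | succ k => exact hc.2 k (Nat.lt_of_succ_lt_succ hk)

/-- The sets belonging to a `μ₂`-essential cell `[x|…]` and to its last face. -/
lemma IsMu2Essential.of_cons {x : ArtinMonoid M} {c : List (ArtinMonoid M)}
    (h : IsMu2Essential M (x :: c)) :
    IsMu2Essential M c ∧ IsDelta M (rightDivisors M (x * c.prod)) (x * c.prod) ∧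
      ∃ s, IsGreatest (rightDivisors M (x * c.prod)) s ∧
        rightDivisors M c.prod = rightDivisors M (x * c.prod) \ {s} := by
  obtain ⟨⟨hc, h1⟩, h2⟩ := h
  refine ⟨⟨⟨fun y hy => hc y (List.mem_cons_of_mem _ hy), fun k hk => ?_⟩, fun k hk => ?_⟩, ?_⟩
  · exact h1 (k + 1) (Nat.succ_lt_succ hk)
  · exact h2 (k + 1) (Nat.succ_lt_succ hk)
  obtain ⟨T, T', s, hT, hT', hs, hmax⟩ := h2 0 (Nat.succ_pos _)
  simp only [List.drop_zero, zero_add, List.drop_succ_cons, List.prod_cons] at hT hT'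
  have hsub := rightDivisors_mul_subset M x c.prod
  rw [hT.rightDivisors_eq, hT'.rightDivisors_eq] at *
  refine ⟨hT, s, hmax, ?_⟩
  rw [← hs, Set.sdiff_sdiff_cancel_left hsub]

lemma isMu2Essential_singleton_gen (s : S) : IsMu2Essential M [gen M s] :=
  isMu2Essential_cons (gen_ne_one M s) (by simpa using isDelta_singleton M s)
    (by simpa using isDelta_empty M) (by simp) isGreatest_singleton isMu2Essential_nil

lemma depth2_eq_zero {c : List (ArtinMonoid M)} (h : IsMu2Essential M c) : depth2 M c = 0 :=
  Nat.sInf_eq_zero.2 (Or.inl h)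

lemma IsMu2Essential.eq_nil {c : List (ArtinMonoid M)} (h : IsMu2Essential M c)
    (hI : rightDivisors M c.prod = ∅) : c = [] := by
  cases c with
  | nil => rfl
  | cons x c =>
    obtain ⟨-, -, s, hs, -⟩ := h.of_cons
    rw [List.prod_cons] at hI
    rw [hI] at hs
    exact hs.1.elim

/-- Removing the maximum from `{s}` leaves the empty set, so nothing follows the first entry, which
is then `Δ_{s} = σ_s`. -/
lemma isMu2Essential_and_singleton_iff {c : List (ArtinMonoid M)} {s : S} :
    (IsMu2Essential M c ∧ rightDivisors M c.prod = {s}) ↔ c = [gen M s] := by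
  constructor
  · rintro ⟨h, hI⟩
    cases c with
    | nil =>
      rw [List.prod_nil, (isDelta_empty M).rightDivisors_eq] at hI
      exact absurd hI (Set.singleton_ne_empty s).symm
    | cons x c =>
      rw [List.prod_cons] at hI
      obtain ⟨hc, hΔ, r, hr, hI'⟩ := h.of_cons
      rw [hI] at hΔ hr hI'
      obtain rfl : r = s := hr.1
      rw [Set.sdiff_self] at hI'
      obtain rfl := hc.eq_nil hI'
      have := hΔ.eq (isDelta_singleton M r)
      simpa using this
  · rintro rfl
    exact ⟨isMu2Essential_singleton_gen s, by simpa using (isDelta_singleton M s).rightDivisors_eq⟩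

lemma isGreatest_pair {p q : S} (h : p < q) : IsGreatest {p, q} q :=
  ⟨by simp, by rintro x (rfl | rfl); exacts [h.le, le_rfl]⟩

/-- The `μ₂`-essential cell for `{p, q}` with `p < q`, given that `z σ_p = Δ_{p,q}` determines
`z`. -/
lemma isMu2Essential_and_pair_iff {c : List (ArtinMonoid M)} {p q : S} (h : p < q)
    {z : ArtinMonoid M} (hz : IsDelta M {p, q} (z * gen M p))
    (huniq : ∀ x, x * gen M p = z * gen M p → x = z) :
    (IsMu2Essential M c ∧ rightDivisors M c.prod = {p, q}) ↔ c = [z, gen M p] := by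
  constructor
  · rintro ⟨hc, hI⟩
    cases c with
    | nil =>
      rw [List.prod_nil, (isDelta_empty M).rightDivisors_eq] at hI
      exact absurd hI (Set.insert_nonempty p {q}).ne_empty.symm
    | cons x c =>
      rw [List.prod_cons] at hI
      obtain ⟨hc, hΔ, r, hr, hI'⟩ := hc.of_cons
      rw [hI] at hΔ hr hI'
      -- The letter removed is the maximum `q`, so the rest of the cell belongs to `{p}` and is
      -- `[σ_p]`.
      obtain rfl := hr.unique (isGreatest_pair h)
      rw [pair_diff_right h.ne] at hI'
      obtain rfl := isMu2Essential_and_singleton_iff.1 ⟨hc, hI'⟩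
      rw [List.prod_singleton] at hΔ
      rw [huniq x (hΔ.eq hz)]
  · rintro rfl
    have hI : rightDivisors M (List.prod [z, gen M p]) = {p, q} := by
      simpa using hz.rightDivisors_eq
    have hz1 : z ≠ 1 := by
      rintro rfl
      rw [one_mul] at hz
      have hq : q ∈ ({p} : Set S) := by
        rw [(isDelta_singleton M p).set_eq hz]
        simp
      exact h.ne' hq
    refine ⟨isMu2Essential_cons hz1 (T := {p, q}) (T' := {p}) (s := q) (by simpa using hz)
      (by simpa using isDelta_singleton M p) ?_ (isGreatest_pair h)
      (isMu2Essential_singleton_gen p), hI⟩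
    rw [Set.pair_comm, pair_diff_right h.ne']

lemma IsMatched.isCell {c : List (ArtinMonoid M)} {i : ℕ} (h : IsMatched M c i) : IsCell M c := by
  rcases h with ⟨h, -⟩ | ⟨h, -⟩
  exacts [h.1, h.1.1]

/-- Both depths are 0, whereas a collapsible cell has positive depth. -/
lemma IsMu2Essential.not_isMatched {c : List (ArtinMonoid M)} (h : IsMu2Essential M c) (i : ℕ) :
    ¬ IsMatched M c i := by
  rintro (⟨⟨-, h', -⟩, -⟩ | ⟨⟨-, h', -⟩, -⟩)
  · exact h'.ne' (depth1_eq_zero h.1)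
  · exact h'.ne' (depth2_eq_zero h)

lemma isEssential_nil : IsEssential M [] :=
  ⟨isMu1Essential_nil.1, isMu2Essential_nil.not_isMatched, fun pre post x y h => by simp at h⟩

lemma isEssential_singleton_gen (s : S) : IsEssential M [gen M s] := by
  refine ⟨(isMu1Essential_singleton_gen s).1, (isMu2Essential_singleton_gen s).not_isMatched, ?_⟩
  intro pre post x y h hm
  have hc := hm.isCell
  have hmem : x * y ∈ [gen M s] := by simp [h]
  exact mul_ne_gen (hc x (by simp)) (hc y (by simp)) s (List.mem_singleton.1 hmem)

/-- A collapsible cell with this matched face would be `[x|y|σ_p]` with `x y = z`, because `σ_p`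
does not factor. Either kind of collapsibility would force `y σ_p = Δ_{p,q} = x y σ_p`,
contradicting `x ≠ 1` by length. -/
lemma isEssential_pair {p q : S} (h : p < q) {z : ArtinMonoid M}
    (hz : IsDelta M {p, q} (z * gen M p)) (hess : IsMu2Essential M [z, gen M p]) :
    IsEssential M [z, gen M p] := by
  refine ⟨hess.1.1, hess.not_isMatched, ?_⟩
  intro pre post x y heq hm
  have hc := hm.isCell
  have hx := hc x (by simp)
  have hy := hc y (by simp)
  rcases pre with _ | ⟨x', pre⟩
  · simp only [List.nil_append, List.cons.injEq] at heq
    obtain ⟨rfl, rfl⟩ := heq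
    have key : ¬ IsDelta M {p, q} (y * gen M p) := fun hΔ => by
      have h1 := congrArg (len M) (hΔ.eq hz)
      rw [len_mul, len_mul, len_mul] at h1
      rw [Ne, ← len_eq_zero] at hx
      omega
    rcases hm with ⟨⟨-, -, -, T, hT, hI⟩, hd⟩ | ⟨⟨-, -, -, T, T', r, hT, hT', hr, hr'⟩, hd⟩
    · rw [← hd] at hT hI
      simp only [List.nil_append, List.length_nil, zero_add, List.drop_succ_cons, List.drop_zero,
        List.prod_cons, List.prod_nil, mul_one, tsub_self] at hT hI
      rw [← mul_assoc, hz.rightDivisors_eq] at hI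
      exact key (hI ▸ hT)
    · rw [← hd] at hT hT'
      simp only [List.nil_append, List.length_nil, zero_add, List.drop_succ_cons, List.drop_zero,
        List.prod_cons, List.prod_nil, mul_one, tsub_self] at hT hT'
      rw [← mul_assoc] at hT
      obtain rfl := hT.set_eq hz
      obtain rfl := hr.unique (isGreatest_pair h)
      -- `T'` lies in `{p, q}`, contains `p` because `y σ_p` ends in `σ_p`, and contains `q` because
      -- the two maxima agree.
      have hT'' : T' = {p, r} := by
        refine Set.Subset.antisymm ?_ ?_
        · rw [← hT'.rightDivisors_eq, ← hz.rightDivisors_eq, mul_assoc]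
          exact rightDivisors_mul_subset M _ _
        · rintro a (rfl | rfl)
          · rw [← hT'.rightDivisors_eq]
            exact gen_mem_rightDivisors_mul M _ _
          · exact hr'.1
      exact key (hT'' ▸ hT')
  · have hmem : x * y ∈ [gen M p] := by
      simp only [List.cons_append, List.cons.injEq] at heq
      simp [heq.2]
    exact mul_ne_gen hx hy p (List.mem_singleton.1 hmem)

/-- The edges given by short alternating products are collapsed. -/
lemma isMatched_altProd {s t : S} {k : ℕ} (hk : 1 ≤ k) (hlt : k + 1 < M s t) :
    IsMatched M [altProd (gen M s) (gen M t) k, gen M (altLetter s t k)] 1 := by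
  have hI := rightDivisors_altProd M hlt
  have hsucc : altProd (gen M s) (gen M t) (k + 1) =
      altProd (gen M s) (gen M t) k * gen M (altLetter s t k) := by
    rw [altProd_succ, altLetter_map (gen M)]
  rw [hsucc] at hI
  have hd : depth1 M [altProd (gen M s) (gen M t) k, gen M (altLetter s t k)] = 1 := by
    -- If the product were some `Δ_T`, then `T` would be the set of its right divisors, a single
    -- letter; but `Δ_T` would then have length 1 and not `k + 1 ≥ 2`.
    refine sInf_eq_one ?_ (isMu1Essential_singleton_gen _)
    rintro ⟨-, h⟩
    obtain ⟨T, -, hT⟩ := h 0 (by simp)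
    simp only [List.drop_zero, List.prod_cons, List.prod_nil, mul_one] at hT
    obtain rfl := hT.rightDivisors_eq.symm.trans hI
    have h1 := congrArg (len M) (hT.eq (isDelta_singleton M _))
    rw [← hsucc, len_altProd, len_gen] at h1
    omega
  refine Or.inl ⟨⟨?_, by rw [hd]; exact one_pos, by rw [hd]; exact one_lt_two,
    {altLetter s t k}, ?_, ?_⟩, hd.symm⟩
  · simp only [IsCell, List.forall_mem_cons, List.not_mem_nil, false_imp_iff, implies_true, and_true]
    refine ⟨?_, gen_ne_one M _⟩
    rw [Ne, ← len_eq_zero, len_altProd]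
    omega
  · rw [hd]
    simpa using isDelta_singleton M (altLetter s t k)
  · rw [hd]
    simpa using hI

/-- The edge given by `Δ_{p,q}`, `p < q`, is collapsed along the factorization `x σ_q`. -/
lemma isMatched_pair {p q : S} (h : p < q) {x : ArtinMonoid M} (hx : x ≠ 1)
    (hΔ : IsDelta M {p, q} (x * gen M q)) : IsMatched M [x, gen M q] 1 := by
  have hd : depth2 M [x, gen M q] = 1 := by
    -- Essentiality would require the maximum `q` to be absent from the set of the last entry, which
    -- is `{q}`.
    refine sInf_eq_one ?_ (isMu2Essential_singleton_gen _)
    intro hess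
    obtain ⟨-, -, r, hr, hI⟩ := IsMu2Essential.of_cons hess
    rw [List.prod_singleton] at hr hI
    rw [hΔ.rightDivisors_eq] at hr hI
    obtain rfl := hr.unique (isGreatest_pair h)
    rw [(isDelta_singleton M r).rightDivisors_eq] at hI
    have : r ∈ ({p, r} : Set S) \ {r} := hI ▸ rfl
    exact this.2 rfl
  refine Or.inr ⟨⟨?_, by rw [hd]; exact one_pos, by rw [hd]; exact one_lt_two, {p, q}, {q}, q,
    ?_, ?_, isGreatest_pair h, isGreatest_singleton⟩, hd.symm⟩
  · exact isMu1Essential_cons (T := {p, q}) hx ⟨q, by simp⟩ (by simpa using hΔ)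
      (isMu1Essential_singleton_gen q)
  · rw [hd]
    simpa using hΔ
  · rw [hd]
    simpa using isDelta_singleton M q

lemma isCellOf_singleton_iff (s : S) (c : Σ n : ℕ, Fin n → ArtinMonoid M) :
    IsCellOf M {s} c ↔ c = ⟨1, ![gen M s]⟩ := by
  rw [IsCellOf, isMu2Essential_and_singleton_iff, ← List.ofFn_inj']
  simp

/-- The cell `[z|w]` of `{s, t}` if `Π(s, t, m)` ends in the greater of the two letters. -/
lemma pair_cell {s t : S} (hst : s ≠ t) {k : ℕ} (hk : M s t = k + 1)
    (hlt : altLetter t s k < altLetter s t k) :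
    (∀ c, IsCellOf M {s, t} c ↔
      c = ⟨2, ![altProd (gen M t) (gen M s) k, gen M (altLetter t s k)]⟩) ∧
    IsEssential M [altProd (gen M t) (gen M s) k, gen M (altLetter t s k)] := by
  have hts : M t s = k + 1 := by rw [M.symmetric, hk]
  have hΔ := isDelta_altProd hst.symm hts
  have hiff := fun c => isMu2Essential_and_pair_iff (c := c) hlt hΔ fun x hx =>
    eq_of_mul_gen_eq_altProd M hst.symm hts (hx.trans (by
      rw [hts, altProd_succ, altLetter_map (gen M)]))
  have hset : ({altLetter t s k, altLetter s t k} : Set S) = {s, t} := by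
    unfold altLetter
    split_ifs
    exacts [Set.pair_comm _ _, rfl]
  refine ⟨fun c => ?_, isEssential_pair hlt hΔ ((hiff _).2 rfl).1⟩
  rw [IsCellOf, ← hset, hiff, ← List.ofFn_inj']
  simp

end Cells

/-! ### Loops in the 1-skeleton -/

section Skeleton

variable {S : Type u} [LinearOrder S] {M : CoxeterMatrix S}

lemma baseVertex_mem_skeleton (k : ℕ) : baseVertex M ∈ skeleton M k :=
  ⟨0, Nat.zero_le k, ![], by simpa using isEssential_nil, _, rfl⟩

lemma exists_generator_loop (s : S) :
    ∃ a : Path (⟨baseVertex M, baseVertex_mem_skeleton 1⟩ : skeleton M 1)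
      ⟨baseVertex M, baseVertex_mem_skeleton 1⟩,
      ∀ τ, (a τ : Y M) = edgeCurve M (gen M s) τ :=
  ⟨{ toFun := fun τ => ⟨edgeLoop M (gen M s) τ, 1, le_rfl, ![gen M s],
        by simpa using isEssential_singleton_gen s, _, rfl⟩
     continuous_toFun := (edgeLoop M (gen M s)).continuous.subtype_mk _
     source' := Subtype.ext (edgeLoop M (gen M s)).source
     target' := Subtype.ext (edgeLoop M (gen M s)).target }, fun _ => rfl⟩

variable {v : skeleton M 1}

/-- Lifts the collapse of `[xy]` to `Y¹`: the concatenation taken inside the skeleton already traces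
the curve of `[xy]`, although this edge is not essential. -/
lemma coe_trans_of_isMatched {x y : ArtinMonoid M} (h : IsMatched M [x, y] 1) {γ γ' : Path v v}
    (hγ : ∀ τ, (γ τ : Y M) = edgeCurve M x τ) (hγ' : ∀ τ, (γ' τ : Y M) = edgeCurve M y τ)
    (τ : unitInterval) : (γ.trans γ' τ : Y M) = edgeCurve M (x * y) τ := by
  rw [← edgeLoop_apply, edgeLoop_mul_of_isMatched M h, Path.trans_apply, Path.trans_apply]
  split_ifs
  · exact hγ _
  · exact hγ' _

variable {s t : S} {a b : Path v v}

/-- Each step collapses `[Π_{k+1}]` onto `[Π_k]` followed by its last letter. This stops below `M s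
t`, where the product becomes Δ and its edge is matched differently. -/
lemma exists_loop_altProd (ha : ∀ τ, (a τ : Y M) = edgeCurve M (gen M s) τ)
    (hb : ∀ τ, (b τ : Y M) = edgeCurve M (gen M t) τ) {k : ℕ} (hk : 1 ≤ k) (hlt : k < M s t) :
    ∃ γ : Path v v, (∀ τ, (γ τ : Y M) = edgeCurve M (altProd (gen M s) (gen M t) k) τ) ∧
      loopClass γ = altProd (loopClass a) (loopClass b) k := by
  induction k, hk using Nat.le_induction with
  | base => exact ⟨a, by simpa [altProd_one] using ha, (altProd_one _ _).symm⟩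
  | succ k hk ih =>
    obtain ⟨γ, hγ, hγ'⟩ := ih (Nat.lt_of_succ_lt hlt)
    have hlet : ∀ τ, (altLetter a b k τ : Y M) = edgeCurve M (gen M (altLetter s t k)) τ := by
      unfold altLetter
      split_ifs
      exacts [ha, hb]
    refine ⟨γ.trans (altLetter a b k), fun τ => ?_, ?_⟩
    · rw [coe_trans_of_isMatched (isMatched_altProd hk hlt) hγ hlet, altProd_succ,
        altLetter_map (gen M)]
    · rw [loopClass_trans, hγ', altProd_succ, altLetter_map loopClass]

/-- The boundary of the cell of `{s, t}` if `Π(s, t, m)` ends in the greater of the two letters. -/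
lemma exists_boundary_loop (ha : ∀ τ, (a τ : Y M) = edgeCurve M (gen M s) τ)
    (hb : ∀ τ, (b τ : Y M) = edgeCurve M (gen M t) τ) (hst : s ≠ t) {k : ℕ} (hk : M s t = k + 1)
    (hlt : altLetter t s k < altLetter s t k) :
    ∃ β : Path v v, (∀ τ, (β τ : Y M) = boundaryCurve M (altProd (gen M t) (gen M s) k)
        (gen M (altLetter t s k)) τ) ∧
      loopClass β = altProd (loopClass b) (loopClass a) (M s t) *
        (altProd (loopClass a) (loopClass b) (M s t))⁻¹ := by
  have hm : M s t ≠ 0 := by omega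
  have hts : M t s = k + 1 := by rw [M.symmetric, hk]
  have hk1 : 1 ≤ k := by
    have := two_le_of_ne M hst hm
    omega
  obtain ⟨γ, hγ, hγ'⟩ := exists_loop_altProd ha hb hk1 (by omega)
  obtain ⟨δ, hδ, hδ'⟩ := exists_loop_altProd hb ha hk1 (by omega)
  have hhi : ∀ τ, (altLetter a b k τ : Y M) = edgeCurve M (gen M (altLetter s t k)) τ := by
    unfold altLetter
    split_ifs
    exacts [ha, hb]
  have hlo : ∀ τ, (altLetter b a k τ : Y M) = edgeCurve M (gen M (altLetter t s k)) τ := by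
    unfold altLetter
    split_ifs
    exacts [hb, ha]
  have hΔ := isDelta_altProd hst hk
  have hx : altProd (gen M s) (gen M t) k ≠ 1 := by
    rw [Ne, ← len_eq_zero, len_altProd]
    omega
  -- The edge `[Δ]` collapses along the factorization ending in the greater letter, whereas the
  -- essential cell uses the one ending in the smaller letter.
  have hΔγ := coe_trans_of_isMatched (isMatched_pair hlt hx (by rwa [Set.pair_comm])) hγ hhi
  refine ⟨(δ.trans (altLetter b a k)).trans (γ.trans (altLetter a b k)).symm, fun τ => ?_, ?_⟩
  · rw [boundaryCurve_eq, altProd_mul_gen_comm hk, Path.trans_apply, Path.trans_apply]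
    split_ifs
    · rw [Path.trans_apply, Path.trans_apply]
      split_ifs
      exacts [hδ _, hlo _]
    · exact hΔγ _
  · rw [loopClass_trans, loopClass_symm, loopClass_trans, loopClass_trans, hγ', hδ', hk,
      altProd_succ, altProd_succ, altLetter_map loopClass, altLetter_map loopClass]

end Skeleton

end ArtinMorse

end

theorem mainTheorem6 {S : Type*} [Finite S] [LinearOrder S] (M : CoxeterMatrix S) (s t : S)
    (hst : s ≠ t) (hm : M s t ≠ 0) :
    ∃ z w : ArtinMorse.ArtinMonoid M,
      -- the essential cells for `{s}`, `{t}`, `{s, t}` are `[σ_s]`, `[σ_t]`, `[z|w]`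
      (∀ c, ArtinMorse.IsCellOf M {s} c ↔ c = ⟨1, ![ArtinMorse.gen M s]⟩) ∧
      (∀ c, ArtinMorse.IsCellOf M {t} c ↔ c = ⟨1, ![ArtinMorse.gen M t]⟩) ∧
      (∀ c, ArtinMorse.IsCellOf M {s, t} c ↔ c = ⟨2, ![z, w]⟩) ∧
      ArtinMorse.IsEssential M [ArtinMorse.gen M s] ∧
      ArtinMorse.IsEssential M [ArtinMorse.gen M t] ∧
      ArtinMorse.IsEssential M [z, w] ∧
      -- their curves are loops `a`, `b`, `β` in the `1`-skeleton of `Y`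
      ∃ (v : ArtinMorse.skeleton M 1) (a b β : Path v v),
        (∀ τ, (a τ : ArtinMorse.Y M) = ArtinMorse.edgeCurve M (ArtinMorse.gen M s) τ) ∧
        (∀ τ, (b τ : ArtinMorse.Y M) = ArtinMorse.edgeCurve M (ArtinMorse.gen M t) τ) ∧
        (∀ τ, (β τ : ArtinMorse.Y M) = ArtinMorse.boundaryCurve M z w τ) ∧
        -- up to orientation, `β` is the word in `a` and `b`
        (ArtinMorse.loopClass β = ArtinMorse.relatorWord (ArtinMorse.loopClass a)
            (ArtinMorse.loopClass b) (M s t) ∨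
          ArtinMorse.loopClass β = (ArtinMorse.relatorWord (ArtinMorse.loopClass a)
            (ArtinMorse.loopClass b) (M s t))⁻¹) := by
  obtain ⟨k, hk⟩ : ∃ k, M s t = k + 1 := ⟨M s t - 1, by omega⟩
  have hk' : M t s = k + 1 := by rw [M.symmetric, hk]
  obtain ⟨a, ha⟩ := ArtinMorse.exists_generator_loop (M := M) s
  obtain ⟨b, hb⟩ := ArtinMorse.exists_generator_loop (M := M) t
  -- Which alternating word ends in the greater letter depends on the order of `s`, `t` and the
  -- parity of `M s t`. The second case exchanges the roles of `s` and `t`, which inverts the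
  -- relator; hence the orientation ambiguity.
  rcases lt_or_gt_of_ne (ArtinMorse.altLetter_ne hst.symm k) with hlt | hlt
  · obtain ⟨β, hβ, hβ'⟩ := ArtinMorse.exists_boundary_loop ha hb hst hk hlt
    obtain ⟨hcell, hess⟩ := ArtinMorse.pair_cell hst hk hlt
    exact ⟨_, _, ArtinMorse.isCellOf_singleton_iff s, ArtinMorse.isCellOf_singleton_iff t, hcell,
      ArtinMorse.isEssential_singleton_gen s, ArtinMorse.isEssential_singleton_gen t, hess,
      _, a, b, β, ha, hb, hβ, Or.inr (by rw [ArtinMorse.relatorWord_eq, hβ', mul_inv_rev, inv_inv])⟩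
  · obtain ⟨β, hβ, hβ'⟩ := ArtinMorse.exists_boundary_loop hb ha hst.symm hk' hlt
    obtain ⟨hcell, hess⟩ := ArtinMorse.pair_cell hst.symm hk' hlt
    rw [Set.pair_comm] at hcell
    exact ⟨_, _, ArtinMorse.isCellOf_singleton_iff s, ArtinMorse.isCellOf_singleton_iff t, hcell,
      ArtinMorse.isEssential_singleton_gen s, ArtinMorse.isEssential_singleton_gen t, hess,
      _, a, b, β, ha, hb, hβ, Or.inl (by rw [ArtinMorse.relatorWord_eq, hβ', M.symmetric t s])⟩
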